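/- **Theorem (complexity of model-based OPT-AIL).** *Setting.* Consider an episodic MDP with measurable state and action spaces $\mathcal S,\mathcal A$, horizon $H\ge 1$, fixed initial state $s_1$, true transition functions $P^\star=(P^\star_1,\dots,P^\star_H)$ and true rewards $r^{\mathrm{true}}=(r^{\mathrm{true}}_1,\dots,r^{\mathrm{true}}_H)$, $r^{\mathrm{true}}_h:\mathcal S\times\mathcal A\to[0,1]$. Transition functions $P_h(s'\mid s,a)$ are probability mass functions, or more generally densities with respect to a fixed reference measure $\nu$ on $\mathcal S$. For a policy $\pi=(\pi_h)_h$, $\pi_h:\mathcal S\to\Delta(\mathcal A)$, let $V^\pi_{P,r}$ be its expected return $\mathbb E\sum_h r_h(s_h,a_h)$ under transitions $P$ and reward $r$; put $V^\star_{P,r}=\sup_\pi V^\pi_{P,r}$, $V^\pi_r=V^\pi_{P^\star,r}$ and $V^\pi=V^\pi_{r^{\mathrm{true}}}$. Let $\pi^{\mathrm E}$ be an expert policy. Let $\mathcal R=\prod_h\mathcal R_h$ be a class of (measurable) rewards with values in $[0,1]$ and $\mathcal P=\prod_h\mathcal P_h$ a class of transition functions, with $r^{\mathrm{true}}\in\mathcal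 R$ and $P^\star\in\mathcal P$. *Covering numbers.* $\mathcal N_\rho(\mathcal R_h)$ is the least cardinality of a finite $\mathcal R'\subseteq\mathcal R_h$ such that each $f\in\mathcal R_h$ has some $f'\in\mathcal R'$ with $\sup_{s,a}|f(s,a)-f'(s,a)|\le\rho$; $\mathcal N_\rho(\mathcal P_h;\log)$ is defined in the same way with $\sup_{s,a,s'}|\log f(s'\mid s,a)-\log f'(s'\mid s,a)|\le\rho$ (where $\log 0=-\infty$ matches only itself). *Generalized eluder coefficient.* For $e>0$, $d_{\mathrm{GEC}}(e)$ is the smallest $d\ge 0$ such that for all $r^1,\dots,r^K\in\mathcal R$, all $f^1,\dots,f^K\in\mathcal P$ and all $\pi^k\in\operatorname{argmax}_\pi V^\pi_{f^k,r^k}$, $$\sum_{k=1}^K\big(V^\star_{f^k,r^k}-V^{\pi^k}_{r^k}\big)\le\inf_{\mu>0}\Big\{\frac\mu2\sum_{k=1}^K\sum_{i=1}^{k-1}\mathbb E\Big[\sum_{h=1}^H D_H^2\big(P^\star_h(\cdot\mid s_h,a_h),f^k_h(\cdot\mid s_h,a_h)\big)\,\Big|\,\pi^i\Big]+\frac d{2\mu}\Big\}+\sqrt{dHK}+eHK,$$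 where $D_H^2(p,q)=\int(\sqrt p-\sqrt q)^2d\nu$ and the expectation is under $P^\star$. *Algorithm (model-based OPT-AIL).* The learner has $N\ge1$ i.i.d. expert trajectories $\mathcal D^{\mathrm E}$ and an initial policy $\pi^0$; it runs $K\ge1$ iterations. A trajectory $\tau^k=(s^k_1,a^k_1,\dots,s^k_H,a^k_H,s^k_{H+1})$ of $\pi^k$ is sampled in the true MDP for each $k=0,\dots,K$. In iteration $k=1,\dots,K$ the learner (possibly randomized) chooses $r^k\in\mathcal R$ by an online algorithm from $\mathcal D^{\mathrm E},\tau^0,\dots,\tau^{k-1}$; it chooses $P^k\in\mathcal P$ that minimizes, up to an additive error at most $\varepsilon^P_{\mathrm{opt}}$, the objective $$\mathcal L^k(P)=-\sum_{i=0}^{k-1}\sum_{h=1}^H\log P_h(s^i_{h+1}\mid s^i_h,a^i_h)-\lambda_P V^\star_{P,r^k}$$ over $\mathcal P$; and it takes $\pi^k\in\operatorname{argmax}_\pi V^\pi_{P^k,r^k}$. The output $\bar\pi$ is drawn uniformly from $\{\pi^1,\dots,\pi^K\}$, so $V^{\bar\pi}=\frac1K\sum_{k=1}^KV^{\pi^k}$.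 With $\widehat V^{\pi^k}_r=\sum_h r_h(s^k_h,a^k_h)$ and $\widehat V^{\pi^{\mathrm E}}_r$ the average return of $\mathcal D^{\mathrm E}$ under $r$, the reward optimization error is $$\varepsilon^r_{\mathrm{opt}}=\frac1K\sup_{r\in\mathcal R}\sum_{k=1}^K\Big(\widehat V^{\pi^k}_{r^k}-\widehat V^{\pi^{\mathrm E}}_{r^k}-\big(\widehat V^{\pi^k}_r-\widehat V^{\pi^{\mathrm E}}_r\big)\Big).$$ *Claim.* There are absolute constants $c_1,c_2,C>0$ such that the following holds in every such setting. Let $\varepsilon,\delta\in(0,1]$, let $d>0$ be a real number with $d\ge d_{\mathrm{GEC}}(\varepsilon/(2H))$ (in particular, $d=d_{\mathrm{GEC}}(\varepsilon/(2H))$ if this is finite and positive), let $\rho=c_2\varepsilon^2/(Hd+H)$, suppose that the covering numbers $\mathcal N_\rho(\mathcal R_h)$ and $\mathcal N_\rho(\mathcal P_h;\log)$ are finite with finite maxima over $h$, and let $$\lambda_P=c_1\sqrt{\frac{KH\log\big(H\max_h\mathcal N_\rho(\mathcal P_h;\log)/\delta\big)+K^2H\rho}{d}}.$$ If $$N\ge\frac{C\,H^2\log\big(\max_h\mathcal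 N_\rho(\mathcal R_h)/\delta\big)}{\varepsilon^2},\qquad K\ge\frac{C\,(dH+H^2)\log\big(H\max_h\mathcal N_\rho(\mathcal P_h;\log)/\delta\big)}{\varepsilon^2},$$ then with probability at least $1-\delta$, $$V^{\pi^{\mathrm E}}-V^{\bar\pi}\le\varepsilon+\varepsilon^r_{\mathrm{opt}}+\frac{\varepsilon^P_{\mathrm{opt}}}{\lambda_P}.$$ -/

import Mathlib

open MeasureTheory ProbabilityTheory
open scoped NNReal ENNReal

universe u v w

namespace OptAIL

section Spaces

variable {S : Type u} {A : Type v} [MeasurableSpace S] [MeasurableSpace A]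

/-- A one-step reward function `S × A → [0, 1]` (measurable). -/
def StepReward (S : Type u) (A : Type v) [MeasurableSpace S] [MeasurableSpace A] :
    Type (max u v) :=
  {r : S × A → ℝ // Measurable r ∧ ∀ x, r x ∈ Set.Icc (0 : ℝ) 1}

/-- A one-step transition function `S × A → Δ(S)`, given by its mass function / density
`density (s, a) s' = P(s' | s, a)` with respect to the reference measure `ν` on states.  For a
discrete state space `ν` is the counting measure and the density is the probability mass function.
The field `kernel` is determined by `density`. -/
structure TransitionFn (S : Type u) (A : Type v) [MeasurableSpace S] [MeasurableSpace A]
    (ν : Measure S) where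
  density : S × A → S → ℝ≥0
  measurable_density : Measurable (Function.uncurry density)
  kernel : Kernel (S × A) S
  markov : IsMarkovKernel kernel
  kernel_eq : ∀ x, kernel x = ν.withDensity (fun s' => (density x s' : ℝ≥0∞))

/-- A non-stationary policy: step `h` has a Markov kernel `π_h : S → Δ(A)`. -/
structure Policy (S : Type u) (A : Type v) [MeasurableSpace S] [MeasurableSpace A] (H : ℕ) where
  kernel : Fin H → Kernel S A
  markov : ∀ h, IsMarkovKernel (kernel h)

/-- A trajectory, stored as the sequence of its transitions: entry `h` is `(s_h, a_h, s_{h+1})`.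
Steps are numbered from `0` to `H - 1`. -/
abbrev Traj (S : Type u) (A : Type v) (H : ℕ) : Type (max u v) := Fin H → S × A × S

/-- The law of a trajectory as a function of its first state: draw `a ~ π_0(·|s)`, then
`s' ~ P_0(·|s, a)`, and continue from `s'` with the remaining steps. -/
noncomputable def trajKernel : (H : ℕ) → (Fin H → Kernel S A) → (Fin H → Kernel (S × A) S) →
    Kernel S (Traj S A H)
  | 0, _, _ => Kernel.const S (Measure.dirac (fun i => i.elim0))
  | H + 1, π, P =>
      ((Kernel.id ×ₖ (π 0 ⊗ₖ P 0)) ⊗ₖ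
        (trajKernel H (fun h => π h.succ) (fun h => P h.succ)).comap
          (fun p : S × (S × A × S) => p.2.2.2) (by fun_prop)).map
        (fun p => Fin.cons (α := fun _ => S × A × S) p.1 p.2)

theorem measurable_consTraj (H : ℕ) : Measurable (fun p : (S × A × S) × Traj S A H =>
    (Fin.cons (α := fun _ => S × A × S) p.1 p.2 : Traj S A (H + 1))) := by
  rw [measurable_pi_iff]
  intro i
  refine Fin.cases ?_ (fun j => ?_) i
  · simpa using measurable_fst
  · simp only [Fin.cons_succ]
    fun_prop

/-- The trajectory law is a genuine probability kernel. -/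
theorem isMarkovKernel_trajKernel (H : ℕ) (π : Fin H → Kernel S A) (P : Fin H → Kernel (S × A) S)
    (hπ : ∀ h, IsMarkovKernel (π h)) (hP : ∀ h, IsMarkovKernel (P h)) :
    IsMarkovKernel (trajKernel H π P) := by
  induction H with
  | zero => unfold trajKernel; infer_instance
  | succ H ih =>
    unfold trajKernel
    have h1 := hπ 0
    have h2 := hP 0
    have h3 := ih (fun h => π h.succ) (fun h => P h.succ) (fun h => hπ _) (fun h => hP _)
    exact Kernel.IsMarkovKernel.map _ (measurable_consTraj H)

variable {ν : Measure S} {H : ℕ}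

/-- The law of the trajectory of `π` under the transition functions `P`, started in `s₁`. -/
noncomputable def trajLaw (s₁ : S) (P : Fin H → TransitionFn S A ν) (π : Policy S A H) :
    Measure (Traj S A H) :=
  trajKernel H π.kernel (fun h => (P h).kernel) s₁

/-- The return `∑_h r_h(s_h, a_h)` of a trajectory; for a trajectory `τ` sampled by `π` it is also
the empirical estimate of the value of `π` under `r`. -/
noncomputable def ret (r : Fin H → StepReward S A) (τ : Traj S A H) : ℝ :=
  ∑ h, (r h).1 ((τ h).1, (τ h).2.1)

/-- The policy value `V^π_{P,r}`. -/
noncomputable def value (s₁ : S) (P : Fin H → TransitionFn S A ν) (r : Fin H → StepReward S A)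
    (π : Policy S A H) : ℝ :=
  ∫ τ, ret r τ ∂(trajLaw s₁ P π)

/-- The optimal value `V^*_{P,r}`. -/
noncomputable def optValue (s₁ : S) (P : Fin H → TransitionFn S A ν)
    (r : Fin H → StepReward S A) : ℝ :=
  ⨆ π : Policy S A H, value s₁ P r π

/-- `π ∈ argmax_{π'} V^{π'}_{P,r}`. -/
def IsOptimalPolicy (s₁ : S) (P : Fin H → TransitionFn S A ν) (r : Fin H → StepReward S A)
    (π : Policy S A H) : Prop :=
  ∀ π' : Policy S A H, value s₁ P r π' ≤ value s₁ P r π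

/-- The squared Hellinger distance `∫ (√p - √q)² dν` between `P(·|x)` and `Q(·|x)`. -/
noncomputable def hellingerSq (P Q : TransitionFn S A ν) (x : S × A) : ℝ :=
  ∫ s', (Real.sqrt (P.density x s') - Real.sqrt (Q.density x s')) ^ 2 ∂ν

/-! ### Covering numbers -/

/-- The least cardinality of a finite `T ⊆ F` such that every `f ∈ F` is close to some `f' ∈ T`
(`⊤` if there is no such finite `T`). -/
noncomputable def coveringNumber {X : Type*} (close : X → X → Prop) (F : Set X) : ℕ∞ :=
  ⨅ (T : Finset X) (_ : (T : Set X) ⊆ F ∧ ∀ f ∈ F, ∃ f' ∈ T, close f f'), (T.card : ℕ∞)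

/-- `max_{s,a} |f(s,a) - g(s,a)| ≤ ρ`. -/
def RewardClose (ρ : ℝ) (f g : StepReward S A) : Prop :=
  ∀ x, |f.1 x - g.1 x| ≤ ρ

/-- `max_{s,a,s'} |log f(s'|s,a) - log g(s'|s,a)| ≤ ρ`, with extended-real logarithms: `log 0 = -∞`,
and a zero of `f` is matched exactly by a zero of `g`. -/
def LogClose (ρ : ℝ) (f g : TransitionFn S A ν) : Prop :=
  ∀ x s', ENNReal.log (f.density x s') ≤ ENNReal.log (g.density x s') + (ρ : EReal) ∧
    ENNReal.log (g.density x s') ≤ ENNReal.log (f.density x s') + (ρ : EReal)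

/-- `max_h N_ρ(R_h)`. -/
noncomputable def maxRewardCover (R : Fin H → Set (StepReward S A)) (ρ : ℝ) : ℕ∞ :=
  ⨆ h, coveringNumber (RewardClose ρ) (R h)

/-- `max_h N_ρ(P_h; log)`. -/
noncomputable def maxModelCover (𝓜 : Fin H → Set (TransitionFn S A ν)) (ρ : ℝ) : ℕ∞ :=
  ⨆ h, coveringNumber (LogClose ρ) (𝓜 h)

/-! ### The Markov decision process and its generalized eluder coefficient -/

/-- An episodic Markov decision process with horizon `H` and fixed first state. -/
structure MDP (S : Type u) (A : Type v) [MeasurableSpace S] [MeasurableSpace A] (ν : Measure S)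
    (H : ℕ) where
  init : S
  trans : Fin H → TransitionFn S A ν
  reward : Fin H → StepReward S A

/-- The inequality defining the model-based generalized eluder coefficient at level `e`, for
sequences of length `K`, with constant `d`: the discrepancy of a model is its squared Hellinger
distance to the true transition function, `V(f; r) = V^*_{f,r}` and the policy derived from `(f, r)`
is an optimal policy of `f` under `r`.  Being bounded by an infimum over `μ > 0` is written as being
bounded for all `μ > 0`. -/
def IsGECBound (M : MDP S A ν H) (R : Fin H → Set (StepReward S A))
    (𝓜 : Fin H → Set (TransitionFn S A ν)) (K : ℕ) (e : ℝ) (d : ℝ) : Prop :=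
  ∀ (r : ℕ → Fin H → StepReward S A) (f : ℕ → Fin H → TransitionFn S A ν) (π : ℕ → Policy S A H),
    (∀ k ∈ Finset.Icc 1 K, (∀ h, r k h ∈ R h) ∧ (∀ h, f k h ∈ 𝓜 h) ∧
      IsOptimalPolicy M.init (f k) (r k) (π k)) →
    ∀ μ : ℝ, 0 < μ →
      ∑ k ∈ Finset.Icc 1 K,
          (optValue M.init (f k) (r k) - value M.init M.trans (r k) (π k)) ≤
        μ / 2 * ∑ k ∈ Finset.Icc 1 K, ∑ i ∈ Finset.Ico 1 k,
            ∫ τ, ∑ h, hellingerSq (M.trans h) (f k h) ((τ h).1, (τ h).2.1)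
              ∂(trajLaw M.init M.trans (π i))
          + d / (2 * μ) + Real.sqrt (d * H * K) + e * H * K

/-- The generalized eluder coefficient `d_GEC(e)`: the smallest `d ≥ 0` for which the inequality
holds (`⊤` if there is none). -/
noncomputable def gec (M : MDP S A ν H) (R : Fin H → Set (StepReward S A))
    (𝓜 : Fin H → Set (TransitionFn S A ν)) (K : ℕ) (e : ℝ) : ℝ≥0∞ :=
  ⨅ (d : ℝ≥0) (_ : IsGECBound M R 𝓜 K e d), (d : ℝ≥0∞)

/-! ### The algorithm -/

/-- The negative log-likelihood `-∑_{i<k} ∑_h log P_h(s^i_{h+1} | s^i_h, a^i_h)` of the trajectories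
`τ^0, …, τ^{k-1}`; it is `+∞` if `P` gives likelihood zero to the data. -/
noncomputable def nll (P : Fin H → TransitionFn S A ν) (τ : ℕ → Traj S A H) (k : ℕ) : EReal :=
  -∑ i ∈ Finset.range k, ∑ h,
    ENNReal.log ((P h).density ((τ i h).1, (τ i h).2.1) (τ i h).2.2)

/-- The optimism-regularized objective `NLL^k(P) - lam * V^*_{P,r}`. -/
noncomputable def modelLoss (s₁ : S) (lam : ℝ) (τ : ℕ → Traj S A H) (k : ℕ)
    (r : Fin H → StepReward S A) (P : Fin H → TransitionFn S A ν) : EReal :=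
  nll P τ k - ((lam * optValue s₁ P r : ℝ) : EReal)

/-- The empirical value of the expert: the average return of `N` demonstrations. -/
noncomputable def expertEst {N : ℕ} (D : Fin N → Traj S A H) (r : Fin H → StepReward S A) : ℝ :=
  (1 / (N : ℝ)) * ∑ j, ret r (D j)

end Spaces

/-- A run of `K` iterations of model-based OPT-AIL with `N` expert demonstrations, regularization
coefficient `lam` and model optimization error `εP`, on a probability space `(Ω, μ)`.

`𝒢 k` is the information available in iteration `k` before the roll-out of `π^k`: the expert
demonstrations, the earlier trajectories, and any internal randomness of the learner.  Iteration `k`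
(`1 ≤ k ≤ K`) computes `r^k` from this information by an arbitrary online algorithm, `P^k` by solving
the optimism-regularized maximum-likelihood problem on `τ^0, …, τ^{k-1}` up to the error `εP`, and
`π^k` by planning in `P^k` with reward `r^k`.  The policy `π^k` (`0 ≤ k ≤ K`, with `π^0` the initial
policy) is rolled out in the true MDP and yields `τ^k`. -/
structure Run {S : Type u} {A : Type v} [MeasurableSpace S] [MeasurableSpace A] {ν : Measure S}
    {H : ℕ} (M : MDP S A ν H) (πE : Policy S A H) (R : Fin H → Set (StepReward S A))
    (𝓜 : Fin H → Set (TransitionFn S A ν)) (N K : ℕ) (lam : ℝ)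
    {Ω : Type w} [mΩ : MeasurableSpace Ω] (μ : Measure Ω) (εP : Ω → ℝ) where
  𝒢 : Filtration ℕ mΩ
  /-- the expert demonstrations -/
  expert : Ω → Fin N → Traj S A H
  /-- the trajectories `τ^k` -/
  traj : ℕ → Ω → Traj S A H
  /-- the rewards `r^k` -/
  rew : ℕ → Ω → Fin H → StepReward S A
  /-- the transition models `P^k` -/
  model : ℕ → Ω → Fin H → TransitionFn S A ν
  /-- the policies `π^k` -/
  pol : ℕ → Ω → Policy S A H
  -- The demonstrations are i.i.d. trajectories of the expert policy, available from the start.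
  expert_measurable : Measurable[𝒢 0] expert
  expert_law : μ.map expert = Measure.pi (fun _ : Fin N => trajLaw M.init M.trans πE)
  -- Reward and policy of iteration `k` depend (measurably) on the information `𝒢 k` only.
  rew_measurable : ∀ k ∈ Finset.Icc 1 K, ∀ h,
    Measurable[(𝒢 k).prod inferInstance] (fun p : Ω × (S × A) => (rew k p.1 h).1 p.2)
  pol_measurable : ∀ k ≤ K, ∀ h, ∀ B : Set A, MeasurableSet B →
    Measurable[(𝒢 k).prod inferInstance] (fun p : Ω × S => (pol k p.1).kernel h p.2 B)
  -- The trajectory `τ^k` becomes known after iteration `k`, and its conditional law given `𝒢 k`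
  -- is the trajectory law of `π^k` in the true MDP.
  traj_measurable : ∀ k ≤ K, Measurable[𝒢 (k + 1)] (traj k)
  traj_law : ∀ k ≤ K, ∀ G : Set Ω, MeasurableSet[𝒢 k] G → ∀ B : Set (Traj S A H), MeasurableSet B →
    μ (G ∩ traj k ⁻¹' B) = ∫⁻ ω in G, trajLaw M.init M.trans (pol k ω) B ∂μ
  rew_mem : ∀ k ∈ Finset.Icc 1 K, ∀ ω h, rew k ω h ∈ R h
  model_mem : ∀ k ∈ Finset.Icc 1 K, ∀ ω h, model k ω h ∈ 𝓜 h
  model_opt : ∀ k ∈ Finset.Icc 1 K, ∀ ω, ∀ P : Fin H → TransitionFn S A ν, (∀ h, P h ∈ 𝓜 h) →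
    modelLoss M.init lam (fun i => traj i ω) k (rew k ω) (model k ω) ≤
      modelLoss M.init lam (fun i => traj i ω) k (rew k ω) P + (εP ω : EReal)
  pol_opt : ∀ k ∈ Finset.Icc 1 K, ∀ ω, IsOptimalPolicy M.init (model k ω) (rew k ω) (pol k ω)

namespace Run

variable {S : Type u} {A : Type v} [MeasurableSpace S] [MeasurableSpace A] {ν : Measure S}
    {H : ℕ} {M : MDP S A ν H} {πE : Policy S A H} {R : Fin H → Set (StepReward S A)}
    {𝓜 : Fin H → Set (TransitionFn S A ν)} {N K : ℕ} {lam : ℝ}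
    {Ω : Type w} [MeasurableSpace Ω] {μ : Measure Ω} {εP : Ω → ℝ}

/-- The reward optimization error: the average regret of `r^1, …, r^K` on the estimated losses
`r ↦ ret r τ^k - expertEst r`, against the best fixed reward of the class. -/
noncomputable def rewardOptError (run : Run M πE R 𝓜 N K lam μ εP) (ω : Ω) : ℝ :=
  (1 / (K : ℝ)) * ⨆ r : {r : Fin H → StepReward S A // ∀ h, r h ∈ R h},
    ∑ k ∈ Finset.Icc 1 K,
      ((ret (run.rew k ω) (run.traj k ω) - expertEst (run.expert ω) (run.rew k ω))
        - (ret r.1 (run.traj k ω) - expertEst (run.expert ω) r.1))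

/-- The value (true reward, true transitions) of the output policy, which is drawn uniformly from
`π^1, …, π^K`. -/
noncomputable def outputValue (run : Run M πE R 𝓜 N K lam μ εP) (ω : Ω) : ℝ :=
  ∑ k ∈ Finset.Icc 1 K, (1 / (K : ℝ)) * value M.init M.trans M.reward (run.pol k ω)

/-- The imitation gap of the output policy. -/
noncomputable def imitationGap (run : Run M πE R 𝓜 N K lam μ εP) (ω : Ω) : ℝ :=
  value M.init M.trans M.reward πE - run.outputValue ω

end Run

end OptAIL

/-! Adding and subtracting values and estimates for `r^k` splits the imitation gap of each iteration
exactly into four terms (`imitationGap_le`): the error of the expert estimate for the reward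
difference `r^true - r^k`; the deviation of the return of `τ^k` from its conditional mean; the
regret of `r^k` against `r^true`, which averages to at most `ε_opt^r` since `r^true` is a
competitor; and the planning gap of `π^k` for its own reward `r^k`.

The planning gap is at most `(V^*_{P^⋆,r^k} - V^*_{P^k,r^k}) + (V^*_{P^k,r^k} - V^{π^k}_{r^k})`.
Comparing `P^k` with `P^⋆` in the regularized likelihood objective bounds `λ_P` times the first
bracket by the optimization error plus a log-likelihood ratio (`sum_optimism_le`). That ratio is
small and even carries a negative Hellinger term: given the past, the root likelihood ratio of a
transition has mean `E[1 - D_H²/2] ≤ exp(-E[D_H²]/2)`, so after normalization its products over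
iterations are supermartingales (`lintegral_modelFactor_le`, `exists_model_event`). The eluder
inequality bounds the second bracket by the same Hellinger sum with a free weight, chosen so that
the two cancel (`sum_value_gap_le`). The value of `λ_P` makes the remainder a small multiple of `Kε`
(`optimism_tradeoff`).

The sample sizes contain no `log K`, and that of the expert no `log H`. Instead of a union bound
over iterations and steps, the exponential moments are summed over all indices, Markov's inequality
is applied once, and convexity of `exp` bounds the average exponent
(`sum_le_card_mul_of_sum_exp_le`). Only the cover is paid for in probability. Treating each step
separately also avoids covers of the product classes.

The logarithms in the sample sizes can vanish, so three degenerate cases need their own argument. A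
one-element reward cover makes the expert error deterministic. With `H = 1` transitions do not
affect returns, so planning is exact. For `δ` near `1` the failure probabilities are combined
conditionally on the expert data (`measure_compl_union_diff_le`). -/

namespace OptAIL

/-! ### Integration along trajectories -/

section Trajectories

variable {S : Type u} {A : Type v} [MeasurableSpace S] [MeasurableSpace A]

/-- One-step unfolding of the trajectory law. The later inductions on the horizon rest on this
formula. -/
theorem lintegral_trajKernel_succ {H : ℕ} (π : Fin (H + 1) → Kernel S A)
    (P : Fin (H + 1) → Kernel (S × A) S) (hπ : ∀ h, IsMarkovKernel (π h))
    (hP : ∀ h, IsMarkovKernel (P h)) (s : S) {F : Traj S A (H + 1) → ℝ≥0∞} (hF : Measurable F) :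
    ∫⁻ τ, F τ ∂(trajKernel (H + 1) π P s) =
      ∫⁻ a, ∫⁻ s', ∫⁻ τ, F (Fin.cons (α := fun _ => S × A × S) (s, a, s') τ)
        ∂(trajKernel H (fun h => π h.succ) (fun h => P h.succ) s') ∂(P 0 (s, a)) ∂(π 0 s) := by
  have := hπ 0
  have := hP 0
  have := isMarkovKernel_trajKernel H (fun h => π h.succ) (fun h => P h.succ) (fun h => hπ _)
    (fun h => hP _)
  have hc : Measurable fun q : (S × A × S) × Traj S A H =>
      F (Fin.cons (α := fun _ => S × A × S) q.1 q.2) := hF.comp (measurable_consTraj H)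
  have h1 : Measurable fun p : S × A × S => ∫⁻ τ, F (Fin.cons (α := fun _ => S × A × S) p τ)
      ∂(trajKernel H (fun h => π h.succ) (fun h => P h.succ) p.2.2) :=
    Measurable.lintegral_kernel_prod_right'
      (κ := (trajKernel H (fun h => π h.succ) (fun h => P h.succ)).comap
        (fun p : S × A × S => p.2.2) (by fun_prop)) hc
  rw [trajKernel, Kernel.lintegral_map _ (measurable_consTraj H) _ hF,
    Kernel.lintegral_compProd _ _ _ hc]
  simp only [Kernel.comap_apply]
  rw [Kernel.lintegral_id_prod h1]
  exact Kernel.lintegral_compProd _ _ _ (h1.comp (measurable_prodMk_left (x := s)))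

/-- The policies of a run are random. Joint measurability in the parameter and the first state turns
the law of `τ^k` given `𝒢 k` into a kernel; the first state has to vary because the tail of a
trajectory starts at a random state. -/
theorem measurable_trajKernel {Ω : Type w} [MeasurableSpace Ω] {H : ℕ}
    (π : Ω → Fin H → Kernel S A) (P : Fin H → Kernel (S × A) S)
    (hπ : ∀ ω h, IsMarkovKernel (π ω h)) (hP : ∀ h, IsMarkovKernel (P h))
    (hm : ∀ h, ∀ B : Set A, MeasurableSet B → Measurable fun p : Ω × S => π p.1 h p.2 B) :
    Measurable fun p : Ω × S => trajKernel H (π p.1) P p.2 := by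
  induction H with
  | zero =>
    simp only [trajKernel, Kernel.const_apply]
    exact measurable_const
  | succ H ih =>
    have ih' := ih (fun ω h => π ω h.succ) (fun h => P h.succ) (fun ω h => hπ ω _) (fun h => hP _)
      (fun h => hm h.succ)
    refine Measure.measurable_of_measurable_coe _ fun B hB => ?_
    let T : Kernel (Ω × S) (Traj S A H) := ⟨_, ih'⟩
    let Q : Kernel (Ω × S) A :=
      ⟨fun p => π p.1 0 p.2, Measure.measurable_of_measurable_coe _ (hm 0)⟩
    have hT : IsMarkovKernel T := ⟨fun p => (isMarkovKernel_trajKernel H _ _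
      (fun h => hπ p.1 h.succ) (fun h => hP h.succ)).isProbabilityMeasure p.2⟩
    have hQ : IsMarkovKernel Q := ⟨fun p => (hπ p.1 0).isProbabilityMeasure p.2⟩
    have := hP 0
    have key : ∀ p : Ω × S, trajKernel (H + 1) (π p.1) P p.2 B =
        ∫⁻ a, ∫⁻ s', ∫⁻ τ, B.indicator 1 (Fin.cons (α := fun _ => S × A × S) (p.2, a, s') τ)
          ∂(T (p.1, s')) ∂(P 0 (p.2, a)) ∂(Q p) := fun p => by
      rw [← lintegral_indicator_one hB, lintegral_trajKernel_succ _ _ (hπ p.1) hP _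
        (measurable_one.indicator hB)]
      rfl
    simp_rw [key]
    refine Measurable.lintegral_kernel_prod_right' (κ := Q) (f := fun q : (Ω × S) × A =>
      ∫⁻ s', ∫⁻ τ, B.indicator 1 (Fin.cons (α := fun _ => S × A × S) (q.1.2, q.2, s') τ)
          ∂(T (q.1.1, s')) ∂(P 0 (q.1.2, q.2))) ?_
    refine Measurable.lintegral_kernel_prod_right'
      (κ := (P 0).comap (fun q : (Ω × S) × A => (q.1.2, q.2)) (by fun_prop))
      (f := fun q : ((Ω × S) × A) × S =>
      ∫⁻ τ, B.indicator 1 (Fin.cons (α := fun _ => S × A × S) (q.1.1.2, q.1.2, q.2) τ)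
          ∂(T (q.1.1.1, q.2))) ?_
    refine Measurable.lintegral_kernel_prod_right'
      (κ := T.comap (fun q : ((Ω × S) × A) × S => (q.1.1.1, q.2)) (by fun_prop))
      (f := fun q : (((Ω × S) × A) × S) × Traj S A H =>
       B.indicator 1 (Fin.cons (α := fun _ => S × A × S) (q.1.1.1.2, q.1.1.2, q.1.2) q.2)) ?_
    exact (measurable_one.indicator hB).comp ((measurable_consTraj H).comp
      (by fun_prop : Measurable fun q : (((Ω × S) × A) × S) × Traj S A H =>
        ((q.1.1.1.2, q.1.1.2, q.1.2), q.2)))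

/-- Given the state and action of step `h`, the next state is distributed as `P_h`. -/
theorem lintegral_trajKernel_transition {H : ℕ} (π : Fin H → Kernel S A)
    (P : Fin H → Kernel (S × A) S) (hπ : ∀ h, IsMarkovKernel (π h))
    (hP : ∀ h, IsMarkovKernel (P h)) (h : Fin H) (s : S) {F : (S × A) × S → ℝ≥0∞}
    (hF : Measurable F) :
    ∫⁻ τ, F (((τ h).1, (τ h).2.1), (τ h).2.2) ∂(trajKernel H π P s) =
      ∫⁻ τ, ∫⁻ s', F (((τ h).1, (τ h).2.1), s') ∂(P h ((τ h).1, (τ h).2.1))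
        ∂(trajKernel H π P s) := by
  induction H generalizing s with
  | zero => exact h.elim0
  | succ H ih =>
    have := isMarkovKernel_trajKernel H (fun h => π h.succ) (fun h => P h.succ) (fun h => hπ _)
      (fun h => hP _)
    have := hP h
    have hG : Measurable fun x : S × A => ∫⁻ s', F (x, s') ∂(P h x) :=
      hF.lintegral_kernel_prod_right'
    have m1 : Measurable fun τ : Traj S A (H + 1) => F (((τ h).1, (τ h).2.1), (τ h).2.2) :=
      hF.comp (by fun_prop)
    have m2 : Measurable fun τ : Traj S A (H + 1) =>
        ∫⁻ s', F (((τ h).1, (τ h).2.1), s') ∂(P h ((τ h).1, (τ h).2.1)) :=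
      hG.comp (by fun_prop)
    rw [lintegral_trajKernel_succ π P hπ hP s m1, lintegral_trajKernel_succ π P hπ hP s m2]
    refine Fin.cases ?_ (fun j => ?_) h
    · have := hP 0
      simp
    · simp only [Fin.cons_succ]
      simp_rw [ih _ _ (fun h => hπ _) (fun h => hP _) j]

/-- With a single step, the law of the first state and action does not depend on the
transition. -/
theorem lintegral_trajKernel_one (π : Fin 1 → Kernel S A)
    (P : Fin 1 → Kernel (S × A) S) (hπ : ∀ h, IsMarkovKernel (π h))
    (hP : ∀ h, IsMarkovKernel (P h)) (s : S) {F : S × A → ℝ≥0∞} (hF : Measurable F) :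
    ∫⁻ τ, F ((τ 0).1, (τ 0).2.1) ∂(trajKernel 1 π P s) = ∫⁻ a, F (s, a) ∂(π 0 s) := by
  have := isMarkovKernel_trajKernel 0 (fun h => π h.succ) (fun h => P h.succ) (fun h => hπ _)
      (fun h => hP _)
  have := hP 0
  rw [lintegral_trajKernel_succ π P hπ hP s (F := fun τ => F ((τ 0).1, (τ 0).2.1))
    (hF.comp (by fun_prop))]
  simp

end Trajectories

end OptAIL

namespace OptAIL

/-! ### Exponential moments -/

section Moments

/-- The hypothesis on rectangles identifies the joint law of `(Y, X)` with the composition product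
of the law of `Y` and `κ`. The map `Y` will be the identity into a smaller σ-algebra; the separate
codomain keeps the two σ-algebras apart. -/
theorem lintegral_comp_prodMk_eq {Ω Ω' T : Type*} [MeasurableSpace Ω] [MeasurableSpace Ω']
    [MeasurableSpace T] (μ : Measure Ω) [IsProbabilityMeasure μ] (κ : Kernel Ω' T)
    [IsMarkovKernel κ] {Y : Ω → Ω'} (hY : Measurable Y) {X : Ω → T} (hX : Measurable X)
    (hlaw : ∀ G : Set Ω', MeasurableSet G → ∀ B : Set T, MeasurableSet B →
      μ (Y ⁻¹' G ∩ X ⁻¹' B) = ∫⁻ ω in Y ⁻¹' G, κ (Y ω) B ∂μ)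
    {f : Ω' × T → ℝ≥0∞} (hf : Measurable f) :
    ∫⁻ ω, f (Y ω, X ω) ∂μ = ∫⁻ ω, ∫⁻ τ, f (Y ω, τ) ∂(κ (Y ω)) ∂μ := by
  have hpair : Measurable fun ω => (Y ω, X ω) := hY.prodMk hX
  have := Measure.isProbabilityMeasure_map hY.aemeasurable (μ := μ)
  have heq : μ.map (fun ω => (Y ω, X ω)) = (μ.map Y) ⊗ₘ κ := by
    refine Measure.ext_prod fun {G B} hG hB => ?_
    rw [Measure.map_apply hpair (hG.prod hB), Measure.compProd_apply_prod hG hB,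
      setLIntegral_map hG (κ.measurable_coe hB) hY, ← hlaw G hG B hB]
    rfl
  rw [← lintegral_map hf hpair, heq, Measure.lintegral_compProd hf,
    lintegral_map hf.lintegral_kernel_prod_right' hY]

/-- If `κ ω` is the conditional law of `X` given `m`, then integrating a function of an `m`-measurable
quantity and of `X` amounts to integrating out `X` first. -/
theorem lintegral_comp_of_condLaw {Ω T : Type*} {m mΩ : MeasurableSpace Ω} [MeasurableSpace T]
    (hm : m ≤ mΩ) (μ : Measure[mΩ] Ω) [IsProbabilityMeasure μ] {κ : Ω → Measure T}
    (hκ : Measurable[m] κ) (hprob : ∀ ω, IsProbabilityMeasure (κ ω)) {X : Ω → T}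
    (hX : Measurable[mΩ] X)
    (hlaw : ∀ G : Set Ω, MeasurableSet[m] G → ∀ B : Set T, MeasurableSet B →
      μ (G ∩ X ⁻¹' B) = ∫⁻ ω in G, κ ω B ∂μ)
    {f : Ω × T → ℝ≥0∞} (hf : Measurable[m.prod inferInstance] f) :
    ∫⁻ ω, f (ω, X ω) ∂μ = ∫⁻ ω, ∫⁻ τ, f (ω, τ) ∂(κ ω) ∂μ :=
  @lintegral_comp_prodMk_eq Ω Ω T mΩ m _ μ _ (@Kernel.mk Ω T m _ κ hκ)
    (@IsMarkovKernel.mk Ω T m _ _ hprob) id (measurable_id'' hm) X hX hlaw f hf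

theorem measurable_integral_of_measurable {Ω T : Type*} [MeasurableSpace Ω] [MeasurableSpace T]
    {κ : Ω → Measure T} (hκ : Measurable κ) (hprob : ∀ ω, IsProbabilityMeasure (κ ω))
    {f : Ω × T → ℝ} (hf : Measurable f) : Measurable fun ω => ∫ τ, f (ω, τ) ∂(κ ω) :=
  have : IsMarkovKernel (⟨κ, hκ⟩ : Kernel Ω T) := ⟨hprob⟩
  (hf.stronglyMeasurable.integral_kernel_prod_right' (κ := (⟨κ, hκ⟩ : Kernel Ω T))).measurable

theorem measurable_prod_adapted {Ω T : Type*} {mΩ : MeasurableSpace Ω} [MeasurableSpace T]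
    (𝒢 : Filtration ℕ mΩ) (X : ℕ → Ω → T) (g : ℕ → Ω × T → ℝ≥0∞) (n : ℕ)
    (hX : ∀ i < n, Measurable[𝒢 (i + 1)] (X i))
    (hg : ∀ i < n, Measurable[(𝒢 i).prod inferInstance] (g i)) :
    Measurable[𝒢 n] fun ω => ∏ i ∈ Finset.range n, g i (ω, X i ω) := by
  refine @Finset.measurable_fun_prod _ _ _ _ _ _ (𝒢 n) _ _ fun i hi => ?_
  have hi' : i < n := Finset.mem_range.mp hi
  refine (hg i (by omega)).comp (Measurable.prodMk ?_ ?_)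
  · exact measurable_id'' (𝒢.mono hi'.le)
  · exact (hX i (by omega)).mono (𝒢.mono hi') le_rfl

/-- Markov's inequality for `μ` restricted to `G`. Keeping the factor `μ G` makes the later failure
bounds conditional on the initial information. -/
theorem measure_inter_ge_le {Ω : Type*} [MeasurableSpace Ω] (μ : Measure Ω) {F : Ω → ℝ≥0∞}
    (hF : Measurable F) {G : Set Ω} {B : ℝ≥0∞} {c : ℝ} (hc : 0 < c)
    (h : ∫⁻ ω in G, F ω ∂μ ≤ B * μ G) :
    μ (G ∩ {ω | ENNReal.ofReal c ≤ F ω}) ≤ B / ENNReal.ofReal c * μ G := by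
  have h1 := meas_ge_le_lintegral_div (μ := μ.restrict G) hF.aemeasurable
    (ε := ENNReal.ofReal c) (by simpa using hc) ENNReal.ofReal_ne_top
  rw [Measure.restrict_apply (measurableSet_le measurable_const hF)] at h1
  rw [Set.inter_comm]
  calc _ ≤ _ := h1
    _ ≤ B * μ G / ENNReal.ofReal c := by gcongr
    _ = _ := by rw [ENNReal.mul_div_right_comm]

/-- A product of adapted factors with conditional means at most `c i` has conditional mean at most
`∏ c i`. -/
theorem setLIntegral_prod_le_of_condLaw {Ω T : Type*} {mΩ : MeasurableSpace Ω}
    [MeasurableSpace T] (𝒢 : Filtration ℕ mΩ) (μ : Measure Ω) [IsProbabilityMeasure μ]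
    (κ : ℕ → Ω → Measure T) (X : ℕ → Ω → T) (g : ℕ → Ω × T → ℝ≥0∞) (c : ℕ → ℝ≥0∞) (n : ℕ)
    (hκ : ∀ i < n, Measurable[𝒢 i] (κ i)) (hprob : ∀ i < n, ∀ ω, IsProbabilityMeasure (κ i ω))
    (hX : ∀ i < n, Measurable[𝒢 (i + 1)] (X i))
    (hlaw : ∀ i < n, ∀ G : Set Ω, MeasurableSet[𝒢 i] G → ∀ B : Set T, MeasurableSet B →
      μ (G ∩ X i ⁻¹' B) = ∫⁻ ω in G, κ i ω B ∂μ)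
    (hg : ∀ i < n, Measurable[(𝒢 i).prod inferInstance] (g i))
    (hc : ∀ i < n, ∀ ω, ∫⁻ τ, g i (ω, τ) ∂(κ i ω) ≤ c i)
    {G : Set Ω} (hG : MeasurableSet[𝒢 0] G) :
    ∫⁻ ω in G, ∏ i ∈ Finset.range n, g i (ω, X i ω) ∂μ ≤ (∏ i ∈ Finset.range n, c i) * μ G := by
  induction n with
  | zero => simp
  | succ n ih =>
    have ih' := ih (fun i hi => hκ i (by omega)) (fun i hi => hprob i (by omega))
      (fun i hi => hX i (by omega)) (fun i hi => hlaw i (by omega)) (fun i hi => hg i (by omega))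
      (fun i hi => hc i (by omega))
    have hΦ := measurable_prod_adapted 𝒢 X g n (fun i hi => hX i (by omega))
      (fun i hi => hg i (by omega))
    set Φ := fun ω => ∏ i ∈ Finset.range n, g i (ω, X i ω) with hΦdef
    have hGΦ : Measurable[𝒢 n] (G.indicator Φ) :=
      hΦ.indicator (𝒢.mono (Nat.zero_le n) G hG)
    have hf : Measurable[(𝒢 n).prod inferInstance]
        fun p : Ω × T => G.indicator Φ p.1 * g n p :=
      Measurable.mul (hGΦ.comp (@measurable_fst Ω T (𝒢 n) _)) (hg n (by omega))
    have hGm : MeasurableSet G := 𝒢.le 0 _ hG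
    calc ∫⁻ ω in G, ∏ i ∈ Finset.range (n + 1), g i (ω, X i ω) ∂μ
        = ∫⁻ ω, G.indicator Φ ω * g n (ω, X n ω) ∂μ := by
          rw [← lintegral_indicator hGm]
          refine lintegral_congr fun ω => ?_
          by_cases hω : ω ∈ G <;> simp [hω, Finset.prod_range_succ, hΦdef]
      _ = ∫⁻ ω, ∫⁻ τ, G.indicator Φ ω * g n (ω, τ) ∂(κ n ω) ∂μ :=
          lintegral_comp_of_condLaw (𝒢.le n) μ (hκ n (by omega)) (hprob n (by omega))
            ((hX n (by omega)).mono (𝒢.le _) le_rfl) (hlaw n (by omega)) hf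
      _ ≤ ∫⁻ ω, G.indicator Φ ω * c n ∂μ := by
          refine lintegral_mono fun ω => ?_
          have hgm : Measurable fun τ => g n (ω, τ) :=
            (hg n (by omega)).comp (@measurable_prodMk_left Ω T (𝒢 n) _ ω)
          simp only
          rw [lintegral_const_mul _ hgm]
          gcongr
          exact hc n (by omega) ω
      _ = (∫⁻ ω in G, Φ ω ∂μ) * c n := by
          rw [lintegral_mul_const _ (hGΦ.mono (𝒢.le n) le_rfl), lintegral_indicator hGm]
      _ ≤ _ := by
          rw [Finset.prod_range_succ, mul_right_comm]
          gcongr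

/-- Hoeffding's lemma at `-s`, since the deviation is mean minus sample. -/
theorem integral_exp_mean_sub_le {T : Type*} [MeasurableSpace T] (ρ : Measure T)
    [IsProbabilityMeasure ρ] {f : T → ℝ} (hf : Measurable f) {a b : ℝ}
    (hab : ∀ x, f x ∈ Set.Icc a b) (s : ℝ) :
    Integrable (fun x => Real.exp (s * (∫ y, f y ∂ρ - f x))) ρ ∧
    ∫ x, Real.exp (s * (∫ y, f y ∂ρ - f x)) ∂ρ ≤ Real.exp (s ^ 2 * (b - a) ^ 2 / 8) := by
  have h := hasSubgaussianMGF_of_mem_Icc (μ := ρ) hf.aemeasurable (ae_of_all _ hab)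
  have heq : (fun x => Real.exp (s * (∫ y, f y ∂ρ - f x))) =
      fun x => Real.exp (-s * (f x - ∫ y, f y ∂ρ)) := by
    ext x; congr 1; ring
  rw [heq]
  refine ⟨h.integrable_exp_mul (-s), (h.mgf_le (-s)).trans_eq ?_⟩
  congr 1
  push_cast
  rw [Real.norm_eq_abs, div_pow, sq_abs]
  ring

theorem lintegral_exp_mean_sub_le {T : Type*} [MeasurableSpace T] (ρ : Measure T)
    [IsProbabilityMeasure ρ] {f : T → ℝ} (hf : Measurable f) {a b : ℝ}
    (hab : ∀ x, f x ∈ Set.Icc a b) (s : ℝ) :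
    ∫⁻ x, ENNReal.ofReal (Real.exp (s * (∫ y, f y ∂ρ - f x))) ∂ρ ≤
      ENNReal.ofReal (Real.exp (s ^ 2 * (b - a) ^ 2 / 8)) := by
  obtain ⟨h1, h2⟩ := integral_exp_mean_sub_le ρ hf hab s
  rw [← ofReal_integral_eq_lintegral_ofReal h1 (ae_of_all _ fun _ => (Real.exp_pos _).le)]
  exact ENNReal.ofReal_le_ofReal h2

/-- By independence the moment is a product of `N` factors, each bounded by Hoeffding's lemma at `s
/ N`. -/
theorem lintegral_exp_mean_sub_empirical_le {T : Type*} [MeasurableSpace T] (ρ : Measure T)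
    [IsProbabilityMeasure ρ] {f : T → ℝ} (hf : Measurable f) {a b : ℝ}
    (hab : ∀ x, f x ∈ Set.Icc a b) (s : ℝ) {N : ℕ} (hN : 1 ≤ N) :
    ∫⁻ D : Fin N → T, ENNReal.ofReal
        (Real.exp (s * (∫ y, f y ∂ρ - (1 / (N : ℝ)) * ∑ j, f (D j)))) ∂(Measure.pi fun _ => ρ) ≤
      ENNReal.ofReal (Real.exp (s ^ 2 * (b - a) ^ 2 / (8 * N))) := by
  obtain ⟨h1, h2⟩ := integral_exp_mean_sub_le ρ hf hab (s / N)
  have hN' : (N : ℝ) ≠ 0 := by positivity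
  have heq : (fun D : Fin N → T =>
        Real.exp (s * (∫ y, f y ∂ρ - (1 / (N : ℝ)) * ∑ j, f (D j)))) =
      fun D => ∏ j, Real.exp (s / N * (∫ y, f y ∂ρ - f (D j))) := by
    ext D
    rw [← Real.exp_sum]
    congr 1
    rw [← Finset.mul_sum, Finset.sum_sub_distrib]
    simp
    field_simp
  have hint : Integrable (fun D : Fin N → T =>
      ∏ j, Real.exp (s / N * (∫ y, f y ∂ρ - f (D j)))) (Measure.pi fun _ => ρ) :=
    Integrable.fintype_prod fun _ => h1
  have hpi := integral_fintype_prod_eq_pow (ι := Fin N) (μ := ρ)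
    fun x => Real.exp (s / N * (∫ y, f y ∂ρ - f x))
  rw [← ofReal_integral_eq_lintegral_ofReal (heq ▸ hint) (ae_of_all _ fun _ => (Real.exp_pos _).le),
    heq, hpi]
  refine ENNReal.ofReal_le_ofReal ?_
  refine (pow_le_pow_left₀ (integral_nonneg fun _ => (Real.exp_pos _).le) h2 _).trans_eq ?_
  rw [← Real.exp_nat_mul, Fintype.card_fin]
  congr 1
  field_simp

/-- If `∑ exp (z i) < n · exp t` over `n` indices, then the average of the `z i` is at most `t`. -/
theorem sum_le_card_mul_of_sum_exp_le {ι : Type*} (I : Finset ι) (z : ι → ℝ) (t : ℝ)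
    (h : ∑ i ∈ I, Real.exp (z i) ≤ I.card * Real.exp t) : ∑ i ∈ I, z i ≤ I.card * t := by
  -- The tangent line of `exp` at `0`, applied to `z i - t`, replaces Jensen's inequality.
  have h1 : ∀ i ∈ I, z i - t + 1 ≤ Real.exp (z i - t) := fun i _ => Real.add_one_le_exp _
  have h2 := Finset.sum_le_sum h1
  have h3 : ∑ i ∈ I, Real.exp (z i - t) ≤ I.card := by
    simp_rw [Real.exp_sub, ← Finset.sum_div]
    rw [div_le_iff₀ (Real.exp_pos t)]
    exact h
  simp only [Finset.sum_add_distrib, Finset.sum_sub_distrib, Finset.sum_const, nsmul_eq_mul] at h2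
  linarith

end Moments

end OptAIL

namespace OptAIL

/-! ### Hellinger affinity of transition functions -/

section Hellinger

variable {S : Type u} {A : Type v} [MeasurableSpace S] [MeasurableSpace A] {ν : Measure S}

theorem TransitionFn.measurable_density_apply (P : TransitionFn S A ν) (x : S × A) :
    Measurable (P.density x) :=
  P.measurable_density.comp measurable_prodMk_left

theorem TransitionFn.lintegral_density (P : TransitionFn S A ν) (x : S × A) :
    ∫⁻ s', P.density x s' ∂ν = 1 := by
  have := P.markov
  have h : P.kernel x Set.univ = 1 := measure_univ
  rwa [P.kernel_eq, withDensity_apply _ MeasurableSet.univ, setLIntegral_univ] at h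

theorem TransitionFn.lintegral_kernel (P : TransitionFn S A ν) (x : S × A) {f : S → ℝ≥0∞}
    (hf : Measurable f) :
    ∫⁻ s', f s' ∂(P.kernel x) = ∫⁻ s', P.density x s' * f s' ∂ν := by
  rw [P.kernel_eq, lintegral_withDensity_eq_lintegral_mul _ _ hf]
  · rfl
  · exact (P.measurable_density_apply x).coe_nnreal_ennreal

theorem TransitionFn.integrable_density (P : TransitionFn S A ν) (x : S × A) :
    Integrable (fun s' => (P.density x s' : ℝ)) ν := by
  refine ⟨(P.measurable_density_apply x).coe_nnreal_real.aestronglyMeasurable, ?_⟩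
  rw [hasFiniteIntegral_iff_ofReal (ae_of_all _ fun _ => NNReal.coe_nonneg _)]
  simp [P.lintegral_density]

theorem TransitionFn.integral_density (P : TransitionFn S A ν) (x : S × A) :
    ∫ s', (P.density x s' : ℝ) ∂ν = 1 := by
  rw [integral_eq_lintegral_of_nonneg_ae (ae_of_all _ fun _ => NNReal.coe_nonneg _)
    (P.measurable_density_apply x).coe_nnreal_real.aestronglyMeasurable]
  simp [P.lintegral_density]

/-- The Hellinger affinity `∫ √(p q) dν`. -/
noncomputable def affinity (P Q : TransitionFn S A ν) (x : S × A) : ℝ :=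
  ∫ s', Real.sqrt (P.density x s') * Real.sqrt (Q.density x s') ∂ν

theorem measurable_sqrt_mul_sqrt (P Q : TransitionFn S A ν) (x : S × A) :
    Measurable fun s' => Real.sqrt (P.density x s') * Real.sqrt (Q.density x s') :=
  (P.measurable_density_apply x).coe_nnreal_real.sqrt.mul
    (Q.measurable_density_apply x).coe_nnreal_real.sqrt

theorem integrable_sqrt_mul_sqrt (P Q : TransitionFn S A ν) (x : S × A) :
    Integrable (fun s' => Real.sqrt (P.density x s') * Real.sqrt (Q.density x s')) ν := by
  refine ((P.integrable_density x).add (Q.integrable_density x)).mono'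
    (measurable_sqrt_mul_sqrt P Q x).aestronglyMeasurable (ae_of_all _ fun s' => ?_)
  have h1 := Real.sq_sqrt (NNReal.coe_nonneg (P.density x s'))
  have h2 := Real.sq_sqrt (NNReal.coe_nonneg (Q.density x s'))
  have h3 := Real.sqrt_nonneg (P.density x s' : ℝ)
  have h4 := Real.sqrt_nonneg (Q.density x s' : ℝ)
  rw [Real.norm_of_nonneg (mul_nonneg h3 h4)]
  simp only [Pi.add_apply]
  nlinarith [sq_nonneg (Real.sqrt (P.density x s' : ℝ) - Real.sqrt (Q.density x s' : ℝ)),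
    mul_nonneg h3 h4]

theorem hellingerSq_eq (P Q : TransitionFn S A ν) (x : S × A) :
    hellingerSq P Q x = 2 - 2 * affinity P Q x := by
  have h : ∀ s', (Real.sqrt (P.density x s') - Real.sqrt (Q.density x s')) ^ 2 =
      (P.density x s' + Q.density x s' : ℝ) -
        2 * (Real.sqrt (P.density x s') * Real.sqrt (Q.density x s')) := fun s' => by
    rw [sub_sq, Real.sq_sqrt (NNReal.coe_nonneg _), Real.sq_sqrt (NNReal.coe_nonneg _)]
    ring
  have hadd : Integrable (fun s' => (P.density x s' + Q.density x s' : ℝ)) ν :=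
    (P.integrable_density x).add (Q.integrable_density x)
  rw [hellingerSq, affinity]
  simp_rw [h]
  rw [integral_sub hadd
    ((integrable_sqrt_mul_sqrt P Q x).const_mul 2), integral_const_mul,
    integral_add (P.integrable_density x) (Q.integrable_density x), P.integral_density,
    Q.integral_density]
  norm_num

theorem affinity_nonneg (P Q : TransitionFn S A ν) (x : S × A) : 0 ≤ affinity P Q x :=
  integral_nonneg fun _ => mul_nonneg (Real.sqrt_nonneg _) (Real.sqrt_nonneg _)

theorem hellingerSq_nonneg (P Q : TransitionFn S A ν) (x : S × A) : 0 ≤ hellingerSq P Q x :=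
  integral_nonneg fun _ => sq_nonneg _

theorem affinity_le_one (P Q : TransitionFn S A ν) (x : S × A) : affinity P Q x ≤ 1 := by
  linarith [hellingerSq_eq P Q x, hellingerSq_nonneg P Q x]

theorem hellingerSq_le_two (P Q : TransitionFn S A ν) (x : S × A) : hellingerSq P Q x ≤ 2 := by
  linarith [hellingerSq_eq P Q x, affinity_nonneg P Q x]

/-- The affinity as an expectation of a likelihood ratio, which makes sense of its measurability for
an arbitrary reference measure. -/
theorem lintegral_sqrt_ratio (P Q : TransitionFn S A ν) (x : S × A) :
    ∫⁻ s', ENNReal.ofReal (Real.sqrt (Q.density x s' / P.density x s')) ∂(P.kernel x) =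
      ENNReal.ofReal (affinity P Q x) := by
  have hm : Measurable fun s' =>
      ENNReal.ofReal (Real.sqrt (Q.density x s' / P.density x s')) :=
    ((Q.measurable_density_apply x).coe_nnreal_real.div
      (P.measurable_density_apply x).coe_nnreal_real).sqrt.ennreal_ofReal
  rw [P.lintegral_kernel x hm, affinity, ofReal_integral_eq_lintegral_ofReal
    (integrable_sqrt_mul_sqrt P Q x)
    (ae_of_all _ fun _ => mul_nonneg (Real.sqrt_nonneg _) (Real.sqrt_nonneg _))]
  refine lintegral_congr fun s' => ?_
  rw [← ENNReal.ofReal_coe_nnreal, ← ENNReal.ofReal_mul (NNReal.coe_nonneg _)]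
  congr 1
  rcases eq_or_lt_of_le (NNReal.coe_nonneg (P.density x s')) with h | h
  · simp [← h]
  · rw [Real.sqrt_div (NNReal.coe_nonneg _)]
    have h1 := Real.sq_sqrt h.le
    have h2 := Real.sqrt_pos.mpr h
    field_simp
    rw [h1, mul_comm]

theorem measurable_sqrt_ratio (P Q : TransitionFn S A ν) :
    Measurable fun p : (S × A) × S =>
      ENNReal.ofReal (Real.sqrt (Q.density p.1 p.2 / P.density p.1 p.2)) :=
  (Q.measurable_density.coe_nnreal_real.div P.measurable_density.coe_nnreal_real).sqrt.ennreal_ofReal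

/-- No σ-finiteness of `ν` is assumed, so the parametric integral is rewritten as one against the
Markov kernel of `P`. -/
theorem measurable_affinity (P Q : TransitionFn S A ν) : Measurable (affinity P Q) := by
  have h : affinity P Q = fun x =>
      (∫⁻ s', ENNReal.ofReal (Real.sqrt (Q.density x s' / P.density x s')) ∂(P.kernel x)).toReal := by
    ext x
    rw [lintegral_sqrt_ratio, ENNReal.toReal_ofReal (affinity_nonneg P Q x)]
  have := P.markov
  rw [h]
  exact (Measurable.lintegral_kernel_prod_right' (κ := P.kernel)
    (measurable_sqrt_ratio P Q)).ennreal_toReal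

theorem measurable_hellingerSq (P Q : TransitionFn S A ν) : Measurable (hellingerSq P Q) := by
  rw [funext (hellingerSq_eq P Q)]
  exact ((measurable_affinity P Q).const_mul 2).const_sub 2

theorem coe_le_exp_mul_of_log_le {a b : ℝ≥0} {ρ : ℝ}
    (h : ENNReal.log a ≤ ENNReal.log b + (ρ : EReal)) : (a : ℝ) ≤ Real.exp ρ * b := by
  rcases eq_or_ne a 0 with rfl | ha
  · simp only [NNReal.coe_zero]; positivity
  rcases eq_or_ne b 0 with rfl | hb
  · simp [ha] at h
  have ha' : (0 : ℝ) < a := by positivity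
  have hb' : (0 : ℝ) < b := by positivity
  rw [ENNReal.log_pos_real (by simpa using ha) (by simp), ENNReal.log_pos_real (by simpa using hb)
    (by simp), ← EReal.coe_add, EReal.coe_le_coe_iff] at h
  simp only [ENNReal.coe_toReal] at h
  rw [← Real.exp_log hb', ← Real.exp_add, ← Real.log_le_iff_le_exp ha']
  linarith

theorem LogClose.le_exp_mul {ρ : ℝ} {f g : TransitionFn S A ν} (h : LogClose ρ f g) (x : S × A)
    (s' : S) : (f.density x s' : ℝ) ≤ Real.exp ρ * g.density x s' :=
  coe_le_exp_mul_of_log_le (h x s').1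

theorem LogClose.ge_exp_mul {ρ : ℝ} {f g : TransitionFn S A ν} (h : LogClose ρ f g) (x : S × A)
    (s' : S) : (g.density x s' : ℝ) ≤ Real.exp ρ * f.density x s' :=
  coe_le_exp_mul_of_log_le (h x s').2

/-- Log-closeness multiplies the root density by at least `e^{-ρ/2}`. The affinity, being at most
`1`, therefore drops by at most `ρ / 2`, and the squared distance is `2 - 2 ·` affinity. -/
theorem hellingerSq_le_of_logClose {ρ : ℝ} (hρ : 0 ≤ ρ) {f g : TransitionFn S A ν}
    (h : LogClose ρ f g) (P : TransitionFn S A ν) (x : S × A) :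
    hellingerSq P f x ≤ hellingerSq P g x + ρ := by
  have h1 : Real.exp (-(ρ / 2)) * affinity P g x ≤ affinity P f x := by
    rw [affinity, affinity, ← integral_const_mul]
    refine integral_mono ((integrable_sqrt_mul_sqrt P g x).const_mul _)
      (integrable_sqrt_mul_sqrt P f x) fun s' => ?_
    have h2 := Real.sqrt_le_sqrt (h.ge_exp_mul x s')
    rw [Real.sqrt_mul (Real.exp_pos _).le, ← Real.exp_half] at h2
    have h3 : Real.exp (-(ρ / 2)) * Real.sqrt (g.density x s') ≤ Real.sqrt (f.density x s') := by
      rw [Real.exp_neg, inv_mul_le_iff₀ (Real.exp_pos _)]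
      exact h2
    calc _ = Real.sqrt (P.density x s') *
          (Real.exp (-(ρ / 2)) * Real.sqrt (g.density x s')) := by ring
      _ ≤ _ := mul_le_mul_of_nonneg_left h3 (Real.sqrt_nonneg _)
  rw [hellingerSq_eq, hellingerSq_eq]
  nlinarith [Real.add_one_le_exp (-(ρ / 2)), affinity_nonneg P g x, affinity_le_one P g x]

end Hellinger

/-! ### Returns and values -/

section Values

variable {S : Type u} {A : Type v} [MeasurableSpace S] [MeasurableSpace A] {ν : Measure S} {H : ℕ}

theorem isProbabilityMeasure_trajLaw (s₁ : S) (P : Fin H → TransitionFn S A ν)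
    (π : Policy S A H) : IsProbabilityMeasure (trajLaw s₁ P π) :=
  (isMarkovKernel_trajKernel H π.kernel _ π.markov fun h => (P h).markov).isProbabilityMeasure s₁

theorem measurable_reward_step (r : StepReward S A) (h : Fin H) :
    Measurable fun τ : Traj S A H => r.1 ((τ h).1, (τ h).2.1) :=
  r.2.1.comp (by fun_prop)

theorem measurable_ret (r : Fin H → StepReward S A) : Measurable (ret r) :=
  Finset.measurable_fun_sum _ fun h _ => measurable_reward_step (r h) h

theorem ret_nonneg (r : Fin H → StepReward S A) (τ : Traj S A H) : 0 ≤ ret r τ :=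
  Finset.sum_nonneg fun h _ => ((r h).2.2 _).1

theorem ret_le (r : Fin H → StepReward S A) (τ : Traj S A H) : ret r τ ≤ H := by
  calc ret r τ ≤ ∑ _h : Fin H, (1 : ℝ) := Finset.sum_le_sum fun h _ => ((r h).2.2 _).2
    _ = H := by simp

theorem integrable_ret (r : Fin H → StepReward S A) (ρ : Measure (Traj S A H))
    [IsProbabilityMeasure ρ] : Integrable (ret r) ρ :=
  Integrable.of_mem_Icc 0 H (measurable_ret r).aemeasurable
    (ae_of_all _ fun τ => ⟨ret_nonneg r τ, ret_le r τ⟩)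

theorem value_le (s₁ : S) (P : Fin H → TransitionFn S A ν) (r : Fin H → StepReward S A)
    (π : Policy S A H) : value s₁ P r π ≤ H := by
  have := isProbabilityMeasure_trajLaw s₁ P π
  calc value s₁ P r π ≤ ∫ _, (H : ℝ) ∂(trajLaw s₁ P π) :=
        integral_mono (integrable_ret r _) (integrable_const _) fun τ => ret_le r τ
    _ = H := by simp

theorem value_le_optValue (s₁ : S) (P : Fin H → TransitionFn S A ν) (r : Fin H → StepReward S A)
    (π : Policy S A H) : value s₁ P r π ≤ optValue s₁ P r :=
  le_ciSup (f := fun π => value s₁ P r π) ⟨H, by rintro _ ⟨π, rfl⟩; exact value_le s₁ P r π⟩ π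

/-- The only reward is collected at the first state and action, before any transition matters. -/
theorem value_eq_of_horizon_one (hH : H = 1) (s₁ : S) (P Q : Fin H → TransitionFn S A ν)
    (r : Fin H → StepReward S A) (π : Policy S A H) : value s₁ P r π = value s₁ Q r π := by
  subst hH
  have key : ∀ P : Fin 1 → TransitionFn S A ν, value s₁ P r π =
      (∫⁻ a, ENNReal.ofReal ((r 0).1 (s₁, a)) ∂(π.kernel 0 s₁)).toReal := fun P => by
    rw [value, integral_eq_lintegral_of_nonneg_ae (ae_of_all _ fun τ => ret_nonneg r τ)
      (measurable_ret r).aestronglyMeasurable]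
    simp only [ret, Fin.sum_univ_one]
    rw [trajLaw, lintegral_trajKernel_one π.kernel _ π.markov (fun h => (P h).markov) s₁
      (F := fun x => ENNReal.ofReal ((r 0).1 x)) (r 0).2.1.ennreal_ofReal]
  rw [key, key]

end Values

/-! ### Covering numbers and the eluder coefficient -/

section Covers

theorem exists_cover_of_coveringNumber_le {X : Type*} {close : X → X → Prop} {F : Set X} {n : ℕ}
    (h : coveringNumber close F ≤ n) :
    ∃ T : Finset X, (T : Set X) ⊆ F ∧ (∀ f ∈ F, ∃ f' ∈ T, close f f') ∧ T.card ≤ n := by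
  -- A strict bound by `n + 1` lets the infimum yield an actual cover.
  have h1 : coveringNumber close F < ((n + 1 : ℕ) : ℕ∞) :=
    h.trans_lt (by exact_mod_cast Nat.lt_succ_self n)
  unfold coveringNumber at h1
  simp only [iInf_lt_iff] at h1
  obtain ⟨T, ⟨h2, h3⟩, h4⟩ := h1
  exact ⟨T, h2, h3, Nat.lt_succ_iff.mp (by exact_mod_cast h4)⟩

theorem exists_covers_of_iSup_ne_top {X : Type*} {H : ℕ} {close : X → X → Prop}
    {F : Fin H → Set X} (h : ⨆ i, coveringNumber close (F i) ≠ ⊤) :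
    ∃ T : Fin H → Finset X, ∀ i, (T i : Set X) ⊆ F i ∧ (∀ f ∈ F i, ∃ f' ∈ T i, close f f') ∧
      (T i).card ≤ (⨆ i, coveringNumber close (F i)).toNat := by
  refine Classical.skolem.mp fun i => exists_cover_of_coveringNumber_le ?_
  rw [ENat.natCast_toNat h]
  exact le_iSup (fun i => coveringNumber close (F i)) i

variable {S : Type u} {A : Type v} [MeasurableSpace S] [MeasurableSpace A] {ν : Measure S} {H : ℕ}

/-- The infimum defining the coefficient is attained: every `d' > d` dominates an admissible
constant, the right-hand side is monotone and continuous in the constant, and `d'` decreases to `d`.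
-/
theorem isGECBound_of_gec_le {M : MDP S A ν H} {R : Fin H → Set (StepReward S A)}
    {𝓜 : Fin H → Set (TransitionFn S A ν)} {K : ℕ} {e d : ℝ} (hd : 0 ≤ d)
    (h : gec M R 𝓜 K e ≤ ENNReal.ofReal d) : IsGECBound M R 𝓜 K e d := by
  intro r f π hrf μ hμ
  have key : ∀ d' > d, ∑ k ∈ Finset.Icc 1 K,
          (optValue M.init (f k) (r k) - value M.init M.trans (r k) (π k)) ≤
        μ / 2 * ∑ k ∈ Finset.Icc 1 K, ∑ i ∈ Finset.Ico 1 k,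
            ∫ τ, ∑ h, hellingerSq (M.trans h) (f k h) ((τ h).1, (τ h).2.1)
              ∂(trajLaw M.init M.trans (π i))
          + d' / (2 * μ) + Real.sqrt (d' * H * K) + e * H * K := fun d' hd' => by
    have h1 : gec M R 𝓜 K e < ENNReal.ofReal d' :=
      h.trans_lt ((ENNReal.ofReal_lt_ofReal_iff (hd.trans_lt hd')).mpr hd')
    unfold gec at h1
    simp only [iInf_lt_iff] at h1
    obtain ⟨b, hb, hbd⟩ := h1
    have hbd' : (b : ℝ) ≤ d' := by
      rw [← ENNReal.ofReal_coe_nnreal] at hbd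
      exact ((ENNReal.ofReal_lt_ofReal_iff (hd.trans_lt hd')).mp hbd).le
    refine (hb r f π hrf μ hμ).trans ?_
    gcongr
  refine ge_of_tendsto (x := nhdsWithin d (Set.Ioi d)) (f := fun d' : ℝ =>
    μ / 2 * ∑ k ∈ Finset.Icc 1 K, ∑ i ∈ Finset.Ico 1 k,
            ∫ τ, ∑ h, hellingerSq (M.trans h) (f k h) ((τ h).1, (τ h).2.1)
              ∂(trajLaw M.init M.trans (π i))
          + d' / (2 * μ) + Real.sqrt (d' * H * K) + e * H * K) ?_
    (Filter.eventually_of_mem self_mem_nhdsWithin key)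
  refine (Continuous.tendsto ?_ d).mono_left nhdsWithin_le_nhds
  fun_prop

end Covers

end OptAIL

namespace OptAIL

/-! ### Likelihoods -/

section Likelihood

theorem coe_sum_ereal {ι : Type*} (I : Finset ι) (f : ι → ℝ) :
    ∑ i ∈ I, (f i : EReal) = ((∑ i ∈ I, f i : ℝ) : EReal) := by
  classical
  induction I using Finset.induction_on with
  | empty => simp
  | insert a I ha ih => rw [Finset.sum_insert ha, Finset.sum_insert ha, ih, EReal.coe_add]

theorem sum_ereal_eq_bot {ι : Type*} {I : Finset ι} {f : ι → EReal} {i : ι} (hi : i ∈ I)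
    (h : f i = ⊥) : ∑ i ∈ I, f i = ⊥ := by
  classical
  rw [← Finset.add_sum_erase I f hi, h, EReal.bot_add]

variable {S : Type u} {A : Type v} [MeasurableSpace S] [MeasurableSpace A] {ν : Measure S} {H : ℕ}

/-- The density of the `h`-th transition of a trajectory. -/
def stepDensity (P : TransitionFn S A ν) (h : Fin H) (τ : Traj S A H) : ℝ≥0 :=
  P.density ((τ h).1, (τ h).2.1) (τ h).2.2

theorem measurable_stepDensity (P : TransitionFn S A ν) (h : Fin H) :
    Measurable (stepDensity P h) :=
  P.measurable_density.comp
    (by fun_prop : Measurable fun τ : Traj S A H => (((τ h).1, (τ h).2.1), (τ h).2.2))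

theorem log_density_eq {x : ℝ≥0} (h : 0 < x) : ENNReal.log x = ((Real.log x : ℝ) : EReal) := by
  rw [ENNReal.log_pos_real (by simpa using h.ne') (by simp), ENNReal.coe_toReal]

theorem nll_eq_coe {P : Fin H → TransitionFn S A ν} {τ : ℕ → Traj S A H} {k : ℕ}
    (hpos : ∀ i < k, ∀ h, 0 < stepDensity (P h) h (τ i)) :
    nll P τ k =
      ((-∑ i ∈ Finset.range k, ∑ h, Real.log (stepDensity (P h) h (τ i)) : ℝ) : EReal) := by
  rw [nll, EReal.coe_neg, ← coe_sum_ereal]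
  congr 1
  refine Finset.sum_congr rfl fun i hi => ?_
  rw [← coe_sum_ereal]
  exact Finset.sum_congr rfl fun h _ => log_density_eq (hpos i (Finset.mem_range.mp hi) h)

theorem stepDensity_pos_of_nll_ne_top {P : Fin H → TransitionFn S A ν} {τ : ℕ → Traj S A H} {k : ℕ}
    (hn : nll P τ k ≠ ⊤) : ∀ i < k, ∀ h, 0 < stepDensity (P h) h (τ i) := by
  intro i hi h
  rw [pos_iff_ne_zero]
  intro h0
  apply hn
  rw [nll, sum_ereal_eq_bot (Finset.mem_range.mpr hi), EReal.neg_bot]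
  refine sum_ereal_eq_bot (Finset.mem_univ h) ?_
  simpa [stepDensity] using h0

theorem LogClose.log_le {ρ : ℝ} {f g : TransitionFn S A ν} (hc : LogClose ρ f g) {h : Fin H}
    {τ : Traj S A H} (hf : 0 < stepDensity f h τ) :
    0 < stepDensity g h τ ∧
      Real.log (stepDensity f h τ) ≤ Real.log (stepDensity g h τ) + ρ := by
  have h1 : (stepDensity f h τ : ℝ) ≤ Real.exp ρ * stepDensity g h τ := hc.le_exp_mul _ _
  have hf' : (0 : ℝ) < stepDensity f h τ := hf
  have hg : (0 : ℝ) < stepDensity g h τ :=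
    pos_of_mul_pos_right (hf'.trans_le h1) (Real.exp_pos ρ).le
  refine ⟨by exact_mod_cast hg, ?_⟩
  have := Real.log_le_log hf' h1
  rw [Real.log_mul (Real.exp_pos ρ).ne' hg.ne', Real.log_exp] at this
  linarith

/-- Approximate optimality of a model with respect to the true one, in terms of real numbers. -/
theorem modelLoss_le_real {s₁ : S} {lam : ℝ} {τ : ℕ → Traj S A H} {k : ℕ}
    {r : Fin H → StepReward S A} {P Q : Fin H → TransitionFn S A ν} {e : ℝ}
    (hpos : ∀ i < k, ∀ h, 0 < stepDensity (P h) h (τ i))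
    (hle : modelLoss s₁ lam τ k r Q ≤ modelLoss s₁ lam τ k r P + (e : EReal)) :
    (∀ i < k, ∀ h, 0 < stepDensity (Q h) h (τ i)) ∧
      lam * (optValue s₁ P r - optValue s₁ Q r) ≤
        e + ∑ i ∈ Finset.range k, ∑ h,
          (Real.log (stepDensity (Q h) h (τ i)) - Real.log (stepDensity (P h) h (τ i))) := by
  -- The loss of `P` is finite, so that of `Q` is finite too, which excludes zero densities along
  -- the data.
  have hQ : ∀ i < k, ∀ h, 0 < stepDensity (Q h) h (τ i) := by
    refine stepDensity_pos_of_nll_ne_top fun htop => ?_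
    rw [modelLoss, modelLoss, htop, nll_eq_coe hpos, EReal.top_sub_coe, ← EReal.coe_sub,
      ← EReal.coe_add, top_le_iff] at hle
    exact EReal.coe_ne_top _ hle
  refine ⟨hQ, ?_⟩
  rw [modelLoss, modelLoss, nll_eq_coe hpos, nll_eq_coe hQ, ← EReal.coe_sub, ← EReal.coe_sub,
    ← EReal.coe_add, EReal.coe_le_coe_iff] at hle
  simp_rw [Finset.sum_sub_distrib]
  linarith

end Likelihood

/-! ### Concentration along a run -/

namespace Run

variable {S : Type u} {A : Type v} [MeasurableSpace S] [MeasurableSpace A] {ν : Measure S}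
    {H : ℕ} {M : MDP S A ν H} {πE : Policy S A H} {R : Fin H → Set (StepReward S A)}
    {𝓜 : Fin H → Set (TransitionFn S A ν)} {N K : ℕ} {lam : ℝ}
    {Ω : Type w} [mΩ : MeasurableSpace Ω] {μ : Measure Ω} {εP : Ω → ℝ}

theorem measurable_trajLaw (run : Run M πE R 𝓜 N K lam μ εP) {k : ℕ} (hk : k ≤ K) :
    Measurable[run.𝒢 k] fun ω => trajLaw M.init M.trans (run.pol k ω) := by
  have h := @measurable_trajKernel S A _ _ Ω (run.𝒢 k) H (fun ω => (run.pol k ω).kernel)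
    (fun h => (M.trans h).kernel) (fun ω => (run.pol k ω).markov) (fun h => (M.trans h).markov)
    (run.pol_measurable k hk)
  exact h.comp (@measurable_prodMk_right Ω S (run.𝒢 k) _ M.init)

theorem setLIntegral_prod_le (run : Run M πE R 𝓜 N K lam μ εP) [IsProbabilityMeasure μ]
    (g : ℕ → Ω × Traj S A H → ℝ≥0∞) (c : ℝ≥0∞) {n : ℕ} (hn : n ≤ K + 1)
    (hg : ∀ i < n, Measurable[(run.𝒢 i).prod inferInstance] (g i))
    (hc : ∀ i < n, ∀ ω, ∫⁻ τ, g i (ω, τ) ∂(trajLaw M.init M.trans (run.pol i ω)) ≤ c)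
    {G : Set Ω} (hG : MeasurableSet[run.𝒢 0] G) :
    ∫⁻ ω in G, ∏ i ∈ Finset.range n, g i (ω, run.traj i ω) ∂μ ≤ c ^ n * μ G := by
  have h := setLIntegral_prod_le_of_condLaw run.𝒢 μ
    (fun i ω => trajLaw M.init M.trans (run.pol i ω)) run.traj g (fun _ => c) n
    (fun i hi => run.measurable_trajLaw (by omega))
    (fun i _ ω => isProbabilityMeasure_trajLaw _ _ _)
    (fun i hi => run.traj_measurable i (by omega)) (fun i hi => run.traj_law i (by omega))
    hg hc hG
  simpa using h

theorem measurable_prod (run : Run M πE R 𝓜 N K lam μ εP)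
    (g : ℕ → Ω × Traj S A H → ℝ≥0∞) {n : ℕ} (hn : n ≤ K + 1)
    (hg : ∀ i < n, Measurable[(run.𝒢 i).prod inferInstance] (g i)) :
    Measurable fun ω => ∏ i ∈ Finset.range n, g i (ω, run.traj i ω) :=
  (measurable_prod_adapted run.𝒢 run.traj g n (fun i hi => run.traj_measurable i (by omega))
    hg).mono (run.𝒢.le n) le_rfl

/-- The next state is drawn from the true density, which vanishes with probability zero under its
own law. Hence log-likelihoods of the true model are real almost surely. -/
theorem ae_stepDensity_pos (run : Run M πE R 𝓜 N K lam μ εP) :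
    ∀ᵐ ω ∂μ, ∀ i ≤ K, ∀ h, 0 < stepDensity (M.trans h) h (run.traj i ω) := by
  rw [ae_all_iff]
  intro i
  rw [Filter.eventually_imp_distrib_left]
  intro hi
  rw [ae_all_iff]
  intro h
  have hB : MeasurableSet {τ : Traj S A H | stepDensity (M.trans h) h τ = 0} :=
    measurable_stepDensity _ _ (measurableSet_singleton 0)
  have h0 : ∀ π : Policy S A H,
      trajLaw M.init M.trans π {τ | stepDensity (M.trans h) h τ = 0} = 0 := fun π => by
    have hm : MeasurableSet {p : (S × A) × S | (M.trans h).density p.1 p.2 = 0} :=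
      (M.trans h).measurable_density (measurableSet_singleton 0)
    have h1 := lintegral_trajKernel_transition π.kernel (fun h => (M.trans h).kernel) π.markov
      (fun h => (M.trans h).markov) h M.init (measurable_one.indicator hm : Measurable
        ({p : (S × A) × S | (M.trans h).density p.1 p.2 = 0}.indicator (1 : (S × A) × S → ℝ≥0∞)))
    rw [← lintegral_indicator_one hB]
    refine Eq.trans ?_ (h1.trans ?_)
    · rfl
    · refine (lintegral_congr fun τ => ?_).trans lintegral_zero
      refine ((M.trans h).lintegral_kernel _
        ((measurable_one.indicator hm).comp measurable_prodMk_left)).trans ?_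
      refine (lintegral_congr fun s' => ?_).trans lintegral_zero
      by_cases hz : (M.trans h).density ((τ h).1, (τ h).2.1) s' = 0 <;> simp [hz]
  have h2 := run.traj_law i hi Set.univ MeasurableSet.univ _ hB
  simp_rw [h0] at h2
  rw [Set.univ_inter, lintegral_zero] at h2
  rw [ae_iff]
  convert h2 using 2
  ext ω
  simp

/-! #### The models -/

/-- The expected squared Hellinger error of `Q` at step `h` along trajectories of `π`. -/
noncomputable def hellingerError (M : MDP S A ν H) (h : Fin H) (Q : TransitionFn S A ν)
    (π : Policy S A H) : ℝ :=
  ∫ τ, hellingerSq (M.trans h) Q ((τ h).1, (τ h).2.1) ∂(trajLaw M.init M.trans π)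

theorem measurable_hellingerSq_step (P Q : TransitionFn S A ν) (h : Fin H) :
    Measurable fun τ : Traj S A H => hellingerSq P Q ((τ h).1, (τ h).2.1) :=
  (measurable_hellingerSq P Q).comp (by fun_prop)

theorem integrable_hellingerSq_step (P Q : TransitionFn S A ν) (h : Fin H)
    (ρ : Measure (Traj S A H)) [IsProbabilityMeasure ρ] :
    Integrable (fun τ : Traj S A H => hellingerSq P Q ((τ h).1, (τ h).2.1)) ρ :=
  Integrable.of_mem_Icc 0 2 (measurable_hellingerSq_step P Q h).aemeasurable
    (ae_of_all _ fun _ => ⟨hellingerSq_nonneg _ _ _, hellingerSq_le_two _ _ _⟩)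

theorem hellingerError_nonneg (M : MDP S A ν H) (h : Fin H) (Q : TransitionFn S A ν)
    (π : Policy S A H) : 0 ≤ hellingerError M h Q π :=
  integral_nonneg fun _ => hellingerSq_nonneg _ _ _

theorem hellingerError_le_of_logClose (M : MDP S A ν H) (h : Fin H) {ρ : ℝ} (hρ : 0 ≤ ρ)
    {f g : TransitionFn S A ν} (hc : LogClose ρ f g) (π : Policy S A H) :
    hellingerError M h f π ≤ hellingerError M h g π + ρ := by
  have := isProbabilityMeasure_trajLaw M.init M.trans π
  have h1 := integral_mono (μ := trajLaw M.init M.trans π)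
    (integrable_hellingerSq_step (M.trans h) f h _)
    ((integrable_hellingerSq_step (M.trans h) g h _).add (integrable_const ρ))
    fun τ => hellingerSq_le_of_logClose hρ hc (M.trans h) _
  refine h1.trans_eq ?_
  rw [integral_add' (integrable_hellingerSq_step (M.trans h) g h _) (integrable_const ρ)]
  simp [hellingerError]

theorem sum_hellingerError (M : MDP S A ν H) (f : Fin H → TransitionFn S A ν)
    (π : Policy S A H) :
    ∫ τ, ∑ h, hellingerSq (M.trans h) (f h) ((τ h).1, (τ h).2.1) ∂(trajLaw M.init M.trans π) =
      ∑ h, hellingerError M h (f h) π := by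
  have := isProbabilityMeasure_trajLaw M.init M.trans π
  exact integral_finsetSum _ fun h _ => integrable_hellingerSq_step _ _ _ _

/-- The normalized root likelihood ratio of one transition; its conditional mean is at most `1`. -/
noncomputable def modelFactor (run : Run M πE R 𝓜 N K lam μ εP) (h : Fin H)
    (Q : TransitionFn S A ν) (i : ℕ) (p : Ω × Traj S A H) : ℝ≥0∞ :=
  ENNReal.ofReal (Real.sqrt (stepDensity Q h p.2 / stepDensity (M.trans h) h p.2)) *
    ENNReal.ofReal (Real.exp (hellingerError M h Q (run.pol i p.1) / 2))

theorem measurable_modelFactor (run : Run M πE R 𝓜 N K lam μ εP) (h : Fin H)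
    (Q : TransitionFn S A ν) {i : ℕ} (hi : i ≤ K) :
    Measurable[(run.𝒢 i).prod inferInstance] (run.modelFactor h Q i) := by
  have h1 : Measurable fun τ : Traj S A H =>
      ENNReal.ofReal (Real.sqrt (stepDensity Q h τ / stepDensity (M.trans h) h τ)) :=
    ((measurable_stepDensity Q h).coe_nnreal_real.div
      (measurable_stepDensity (M.trans h) h).coe_nnreal_real).sqrt.ennreal_ofReal
  have h2 : Measurable[run.𝒢 i] fun ω => hellingerError M h Q (run.pol i ω) :=
    @measurable_integral_of_measurable Ω _ (run.𝒢 i) _ _ (run.measurable_trajLaw hi)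
      (fun ω => isProbabilityMeasure_trajLaw _ _ _) _
      ((measurable_hellingerSq_step (M.trans h) Q h).comp (@measurable_snd Ω _ (run.𝒢 i) _))
  have h3 : Measurable[run.𝒢 i] fun ω =>
      ENNReal.ofReal (Real.exp (hellingerError M h Q (run.pol i ω) / 2)) :=
    (h2.div_const 2).exp.ennreal_ofReal
  exact (h1.comp (@measurable_snd Ω _ (run.𝒢 i) _)).mul
    (h3.comp (@measurable_fst Ω _ (run.𝒢 i) _))

/-- Integrating out the next state turns the root likelihood ratio into the affinity `1 - D_H²/2`.
Its mean over the trajectory is `1 - e/2 ≤ exp(-e/2)`, where `e` is the expected error, and the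
normalization cancels this. Normalizing by the expected rather than the pathwise error gives
directly the quantity in the eluder inequality. -/
theorem lintegral_modelFactor_le (run : Run M πE R 𝓜 N K lam μ εP) (h : Fin H)
    (Q : TransitionFn S A ν) (i : ℕ) (ω : Ω) :
    ∫⁻ τ, run.modelFactor h Q i (ω, τ) ∂(trajLaw M.init M.trans (run.pol i ω)) ≤ 1 := by
  have := isProbabilityMeasure_trajLaw M.init M.trans (run.pol i ω)
  have h1 := lintegral_trajKernel_transition (run.pol i ω).kernel (fun h => (M.trans h).kernel)
    (run.pol i ω).markov (fun h => (M.trans h).markov) h M.init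
    (measurable_sqrt_ratio (M.trans h) Q)
  simp_rw [lintegral_sqrt_ratio] at h1
  have hm := measurable_hellingerSq_step (M.trans h) Q h
  have haff : ∀ x, affinity (M.trans h) Q x = 1 - hellingerSq (M.trans h) Q x / 2 := fun x => by
    rw [hellingerSq_eq]; ring
  have hint : Integrable (fun τ : Traj S A H => affinity (M.trans h) Q ((τ h).1, (τ h).2.1))
      (trajLaw M.init M.trans (run.pol i ω)) := by
    simp_rw [haff]
    exact (integrable_const 1).sub ((integrable_hellingerSq_step (M.trans h) Q h _).div_const 2)
  have hval : ∫ τ, affinity (M.trans h) Q ((τ h).1, (τ h).2.1)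
      ∂(trajLaw M.init M.trans (run.pol i ω)) =
      1 - hellingerError M h Q (run.pol i ω) / 2 := by
    simp_rw [haff]
    rw [integral_sub (integrable_const 1)
      ((integrable_hellingerSq_step (M.trans h) Q h _).div_const 2), integral_div]
    simp [hellingerError]
  have h1' : ∫⁻ τ, ENNReal.ofReal
      (Real.sqrt (stepDensity Q h τ / stepDensity (M.trans h) h τ))
        ∂(trajLaw M.init M.trans (run.pol i ω)) =
      ENNReal.ofReal (1 - hellingerError M h Q (run.pol i ω) / 2) := by
    rw [← hval, ofReal_integral_eq_lintegral_ofReal hint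
      (ae_of_all _ fun _ => affinity_nonneg _ _ _)]
    exact h1
  unfold modelFactor
  simp only
  rw [lintegral_mul_const' _ _ ENNReal.ofReal_ne_top, h1', ← ENNReal.ofReal_mul' (Real.exp_pos _).le]
  refine ENNReal.ofReal_le_one.mpr ?_
  have h2 := Real.add_one_le_exp (-(hellingerError M h Q (run.pol i ω) / 2))
  calc _ ≤ Real.exp (-(hellingerError M h Q (run.pol i ω) / 2)) *
        Real.exp (hellingerError M h Q (run.pol i ω) / 2) := by
        gcongr
        linarith
    _ = 1 := by rw [← Real.exp_add]; simp

end Run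

end OptAIL

/-! ### Reward perturbations and high-probability events -/

namespace OptAIL

section RewardClose

variable {S : Type u} {A : Type v} [MeasurableSpace S] [MeasurableSpace A] {ν : Measure S} {H : ℕ}
  {ρ : ℝ} {r q : Fin H → StepReward S A}

theorem abs_ret_sub_le (hc : ∀ h, RewardClose ρ (r h) (q h)) (τ : Traj S A H) :
    |ret r τ - ret q τ| ≤ H * ρ := by
  rw [ret, ret, ← Finset.sum_sub_distrib]
  calc _ ≤ ∑ h, |(r h).1 ((τ h).1, (τ h).2.1) - (q h).1 ((τ h).1, (τ h).2.1)| :=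
        Finset.abs_sum_le_sum_abs _ _
    _ ≤ ∑ _h : Fin H, ρ := Finset.sum_le_sum fun h _ => hc h _
    _ = H * ρ := by simp

theorem value_sub_eq (s₁ : S) (P : Fin H → TransitionFn S A ν) (r q : Fin H → StepReward S A)
    (π : Policy S A H) :
    value s₁ P r π - value s₁ P q π = ∫ τ, (ret r τ - ret q τ) ∂(trajLaw s₁ P π) := by
  have := isProbabilityMeasure_trajLaw s₁ P π
  rw [value, value, integral_sub (integrable_ret r _) (integrable_ret q _)]

theorem abs_value_sub_le (hc : ∀ h, RewardClose ρ (r h) (q h)) (s₁ : S)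
    (P : Fin H → TransitionFn S A ν) (π : Policy S A H) :
    |value s₁ P r π - value s₁ P q π| ≤ H * ρ := by
  have := isProbabilityMeasure_trajLaw s₁ P π
  rw [value_sub_eq]
  have h := norm_integral_le_of_norm_le_const (μ := trajLaw s₁ P π)
    (f := fun τ => ret r τ - ret q τ) (ae_of_all _ fun τ => abs_ret_sub_le hc τ)
  simpa using h

theorem abs_expertEst_sub_le (hc : ∀ h, RewardClose ρ (r h) (q h)) {N : ℕ} (hN : 1 ≤ N)
    (D : Fin N → Traj S A H) : |expertEst D r - expertEst D q| ≤ H * ρ := by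
  have hN' : (0 : ℝ) < N := by exact_mod_cast hN
  rw [expertEst, expertEst, ← mul_sub, ← Finset.sum_sub_distrib, abs_mul,
    abs_of_pos (by positivity), one_div, inv_mul_le_iff₀ hN']
  calc _ ≤ ∑ j, |ret r (D j) - ret q (D j)| := Finset.abs_sum_le_sum_abs _ _
    _ ≤ ∑ _j : Fin N, H * ρ := Finset.sum_le_sum fun j _ => abs_ret_sub_le hc _
    _ = N * (H * ρ) := by simp

end RewardClose

theorem sqrt_div_eq_exp {a b : ℝ} (ha : 0 < a) (hb : 0 < b) :
    Real.sqrt (a / b) = Real.exp ((Real.log a - Real.log b) / 2) := by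
  rw [Real.exp_half, Real.exp_sub, Real.exp_log ha, Real.exp_log hb]

theorem ofReal_mul_div_ofReal_mul_exp {a b t : ℝ} (ha : 0 < a) :
    ENNReal.ofReal (a * b) / ENNReal.ofReal (a * Real.exp t) =
      ENNReal.ofReal (b * Real.exp (-t)) := by
  rw [← ENNReal.ofReal_div_of_pos (by positivity), Real.exp_neg]
  congr 1
  field_simp

namespace Run

variable {S : Type u} {A : Type v} [MeasurableSpace S] [MeasurableSpace A] {ν : Measure S}
    {H : ℕ} {M : MDP S A ν H} {πE : Policy S A H} {R : Fin H → Set (StepReward S A)}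
    {𝓜 : Fin H → Set (TransitionFn S A ν)} {N K : ℕ} {lam : ℝ}
    {Ω : Type w} [mΩ : MeasurableSpace Ω] {μ : Measure Ω} {εP : Ω → ℝ}

/-- Uniform control of the log-likelihood ratios of a finite family of models, on average over the
iterations and the steps. -/
theorem exists_model_event (run : Run M πE R 𝓜 N K lam μ εP) [IsProbabilityMeasure μ]
    (hH : 1 ≤ H) (hK : 1 ≤ K) (T : Fin H → Finset (TransitionFn S A ν)) {n : ℕ}
    (hT : ∀ h, (T h).card ≤ n) (t : ℝ) :
    ∃ E : Set Ω, (∀ G, MeasurableSet[run.𝒢 0] G →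
        μ (G \ E) ≤ ENNReal.ofReal (n * Real.exp (-t)) * μ G) ∧
      ∀ ω ∈ E, (∀ i ≤ K, ∀ h, 0 < stepDensity (M.trans h) h (run.traj i ω)) →
        ∀ Q : ℕ → Fin H → TransitionFn S A ν, (∀ k ∈ Finset.Icc 1 K, ∀ h, Q k h ∈ T h) →
        (∀ k ∈ Finset.Icc 1 K, ∀ i < k, ∀ h, 0 < stepDensity (Q k h) h (run.traj i ω)) →
        ∑ k ∈ Finset.Icc 1 K, ∑ h, ∑ i ∈ Finset.range k,
          (Real.log (stepDensity (Q k h) h (run.traj i ω)) -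
            Real.log (stepDensity (M.trans h) h (run.traj i ω)) +
            hellingerError M h (Q k h) (run.pol i ω)) ≤ 2 * (K * H * t) := by
  have hK' : (0 : ℝ) < K := by exact_mod_cast hK
  have hH' : (0 : ℝ) < H := by exact_mod_cast hH
  -- A single sum over iterations, steps and models, of mean at most `K H n` relative to `G`.
  -- Against the threshold `K H e^t` the factor `K H` cancels, leaving only the size `n` of the
  -- cover.
  let F : Ω → ℝ≥0∞ := fun ω => ∑ k ∈ Finset.Icc 1 K, ∑ h, ∑ Q ∈ T h,
    ∏ i ∈ Finset.range k, run.modelFactor h Q i (ω, run.traj i ω)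
  have hkK : ∀ k ∈ Finset.Icc 1 K, k ≤ K + 1 := fun k hk => by
    have := (Finset.mem_Icc.mp hk).2; omega
  have hprod : ∀ k ∈ Finset.Icc 1 K, ∀ h, ∀ Q, Measurable fun ω =>
      ∏ i ∈ Finset.range k, run.modelFactor h Q i (ω, run.traj i ω) := fun k hk h Q =>
    run.measurable_prod _ (hkK k hk) fun i hi => run.measurable_modelFactor h Q
      (by have := (Finset.mem_Icc.mp hk).2; omega)
  have hF : Measurable F := Finset.measurable_fun_sum _ fun k hk => Finset.measurable_fun_sum _
    fun h _ => Finset.measurable_fun_sum _ fun Q _ => hprod k hk h Q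
  refine ⟨{ω | ¬ ENNReal.ofReal (K * H * Real.exp t) ≤ F ω}, fun G hG => ?_, ?_⟩
  · have hint : ∫⁻ ω in G, F ω ∂μ ≤ ENNReal.ofReal (K * H * n) * μ G := by
      rw [lintegral_finsetSum' _ fun k hk => (Finset.measurable_fun_sum _
        fun h _ => Finset.measurable_fun_sum _ fun Q _ => hprod k hk h Q).aemeasurable]
      calc _ ≤ ∑ k ∈ Finset.Icc 1 K, (H * n : ℕ) • μ G := Finset.sum_le_sum fun k hk => ?_
        _ = _ := by
          rw [Finset.sum_const, Nat.card_Icc, Nat.add_sub_cancel, smul_smul, nsmul_eq_mul]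
          congr 1
          rw [← ENNReal.ofReal_natCast]
          push_cast
          ring_nf
      rw [lintegral_finsetSum' _ fun h _ => (Finset.measurable_fun_sum _
        fun Q _ => hprod k hk h Q).aemeasurable]
      calc _ ≤ ∑ h : Fin H, n • μ G := Finset.sum_le_sum fun h _ => ?_
        _ = _ := by simp [mul_assoc]
      rw [lintegral_finsetSum' _ fun Q _ => (hprod k hk h Q).aemeasurable]
      calc _ ≤ ∑ Q ∈ T h, μ G := Finset.sum_le_sum fun Q _ => ?_
        _ ≤ n • μ G := by
          rw [Finset.sum_const]
          exact nsmul_le_nsmul_left zero_le (hT h)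
      have h1 := run.setLIntegral_prod_le (run.modelFactor h Q) 1 (hkK k hk)
        (fun i hi => run.measurable_modelFactor h Q
          (by have := (Finset.mem_Icc.mp hk).2; omega))
        (fun i _ ω => run.lintegral_modelFactor_le h Q i ω) hG
      simpa using h1
    have h2 := measure_inter_ge_le μ hF (c := K * H * Real.exp t) (by positivity) hint
    rw [ofReal_mul_div_ofReal_mul_exp (by positivity)] at h2
    convert h2 using 2
    ext ω
    simp
  · intro ω hω hpos Q hQT hQpos
    -- The square root of the likelihood ratio halves the exponent; this is the factor `2` in the
    -- final bound.
    let z : ℕ × Fin H → ℝ := fun p => (∑ i ∈ Finset.range p.1,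
          (Real.log (stepDensity (Q p.1 p.2) p.2 (run.traj i ω)) -
            Real.log (stepDensity (M.trans p.2) p.2 (run.traj i ω)) +
            hellingerError M p.2 (Q p.1 p.2) (run.pol i ω))) / 2
    have hz : ∀ k ∈ Finset.Icc 1 K, ∀ h, ∏ i ∈ Finset.range k,
        run.modelFactor h (Q k h) i (ω, run.traj i ω) = ENNReal.ofReal (Real.exp (z (k, h))) := by
      intro k hk h
      simp only [z]
      rw [Finset.sum_div, Real.exp_sum, ENNReal.ofReal_prod_of_nonneg
        fun _ _ => (Real.exp_pos _).le]
      refine Finset.prod_congr rfl fun i hi => ?_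
      have hi' := Finset.mem_range.mp hi
      unfold modelFactor
      simp only
      rw [sqrt_div_eq_exp (by exact_mod_cast hQpos k hk i hi' h)
        (by exact_mod_cast hpos i (by have := (Finset.mem_Icc.mp hk).2; omega) h),
        ← ENNReal.ofReal_mul (Real.exp_pos _).le, ← Real.exp_add, ← add_div]
    have hle : ∑ p ∈ Finset.Icc 1 K ×ˢ (Finset.univ : Finset (Fin H)), Real.exp (z p) ≤
        (Finset.Icc 1 K ×ˢ (Finset.univ : Finset (Fin H))).card * Real.exp t := by
      rw [Finset.card_product, Nat.card_Icc, Nat.add_sub_cancel, Finset.card_univ, Fintype.card_fin]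
      push_cast
      rw [← ENNReal.ofReal_le_ofReal_iff (by positivity), ENNReal.ofReal_sum_of_nonneg
        fun _ _ => (Real.exp_pos _).le]
      refine le_trans ?_ (not_le.mp hω).le
      rw [Finset.sum_product]
      refine Finset.sum_le_sum fun k hk => Finset.sum_le_sum fun h _ => ?_
      rw [← hz k hk h]
      exact Finset.single_le_sum (f := fun q => ∏ i ∈ Finset.range k,
        run.modelFactor h q i (ω, run.traj i ω)) (fun _ _ => zero_le) (hQT k hk h)
    have h3 := sum_le_card_mul_of_sum_exp_le _ z t hle
    rw [Finset.card_product, Nat.card_Icc, Nat.add_sub_cancel, Finset.card_univ, Fintype.card_fin,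
      Finset.sum_product] at h3
    push_cast at h3
    simp only [z] at h3
    simp_rw [← Finset.sum_div] at h3
    linarith

/-- The deviation of the return of `τ` from its conditional mean in iteration `k`, for the reward
`r^k` relative to the true reward. -/
noncomputable def rewardDeviation (run : Run M πE R 𝓜 N K lam μ εP) (k : ℕ)
    (p : Ω × Traj S A H) : ℝ :=
  (value M.init M.trans (run.rew k p.1) (run.pol k p.1) -
    value M.init M.trans M.reward (run.pol k p.1)) - (ret (run.rew k p.1) p.2 - ret M.reward p.2)

theorem measurable_rewardDeviation (run : Run M πE R 𝓜 N K lam μ εP) {k : ℕ}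
    (hk : k ∈ Finset.Icc 1 K) :
    Measurable[(run.𝒢 k).prod inferInstance] (run.rewardDeviation k) := by
  have h1 : Measurable[(run.𝒢 k).prod inferInstance] fun p : Ω × Traj S A H =>
      ret (run.rew k p.1) p.2 - ret M.reward p.2 := by
    refine Measurable.sub (Finset.measurable_fun_sum _ fun h _ => ?_)
      ((measurable_ret M.reward).comp (@measurable_snd Ω _ (run.𝒢 k) _))
    exact (run.rew_measurable k hk h).comp (Measurable.prodMk (@measurable_fst Ω _ (run.𝒢 k) _)
      ((by fun_prop : Measurable fun τ : Traj S A H => ((τ h).1, (τ h).2.1)).comp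
        (@measurable_snd Ω _ (run.𝒢 k) _)))
  have h2 := @measurable_integral_of_measurable Ω _ (run.𝒢 k) _ _
    (run.measurable_trajLaw (Finset.mem_Icc.mp hk).2)
    (fun ω => isProbabilityMeasure_trajLaw _ _ _) _ h1
  unfold rewardDeviation
  simp_rw [value_sub_eq]
  exact (h2.comp (@measurable_fst Ω _ (run.𝒢 k) _)).sub h1

theorem lintegral_exp_rewardDeviation_le (run : Run M πE R 𝓜 N K lam μ εP) (k : ℕ) (s : ℝ) (ω : Ω) :
    ∫⁻ τ, ENNReal.ofReal (Real.exp (s * run.rewardDeviation k (ω, τ)))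
        ∂(trajLaw M.init M.trans (run.pol k ω)) ≤
      ENNReal.ofReal (Real.exp (s ^ 2 * H ^ 2 / 2)) := by
  have := isProbabilityMeasure_trajLaw M.init M.trans (run.pol k ω)
  have h := lintegral_exp_mean_sub_le (trajLaw M.init M.trans (run.pol k ω))
    ((measurable_ret (run.rew k ω)).sub (measurable_ret M.reward)) (a := -H) (b := H)
    (fun τ => by
      have h1 := ret_nonneg (run.rew k ω) τ
      have h2 := ret_le (run.rew k ω) τ
      have h3 := ret_nonneg M.reward τ
      have h4 := ret_le M.reward τ
      simp only [Pi.sub_apply]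
      constructor <;> linarith) s
  simp only [Pi.sub_apply] at h
  simp only [rewardDeviation, value_sub_eq]
  convert h using 3
  ring

theorem exists_reward_event (run : Run M πE R 𝓜 N K lam μ εP) [IsProbabilityMeasure μ]
    (hH : 1 ≤ H) (hK : 1 ≤ K) {t : ℝ} (ht : 0 < t) :
    ∃ E : Set Ω, (∀ G, MeasurableSet[run.𝒢 0] G →
        μ (G \ E) ≤ ENNReal.ofReal (Real.exp (-(K * t ^ 2 / (4 * H ^ 2)))) * μ G) ∧
      ∀ ω ∈ E, ∑ k ∈ Finset.Icc 1 K, run.rewardDeviation k (ω, run.traj k ω) ≤ K * t := by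
  have hK' : (1 : ℝ) ≤ K := by exact_mod_cast hK
  have hH' : (0 : ℝ) < H := by exact_mod_cast hH
  -- Minimizes `K s² H² - s K t`, where `K + 1` factors of exponent `s² H² / 2` are bounded using `K
  -- + 1 ≤ 2K`.
  set s : ℝ := t / (2 * H ^ 2) with hs
  have hs0 : 0 < s := by positivity
  -- The index `0` belongs to the roll-out of `π^0`, for which no reward is chosen; its term is set
  -- to zero.
  let z : ℕ → Ω × Traj S A H → ℝ := fun k p => if k = 0 then 0 else run.rewardDeviation k p
  let g : ℕ → Ω × Traj S A H → ℝ≥0∞ := fun k p => ENNReal.ofReal (Real.exp (s * z k p))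
  have hg : ∀ i < K + 1, Measurable[(run.𝒢 i).prod inferInstance] (g i) := by
    intro i hi
    have hz : Measurable[(run.𝒢 i).prod inferInstance] (z i) := by
      rcases Nat.eq_zero_or_pos i with rfl | hi0
      · simp only [z, if_true]
        exact measurable_const
      · simp only [z, hi0.ne', if_false]
        exact run.measurable_rewardDeviation (Finset.mem_Icc.mpr ⟨hi0, by omega⟩)
    exact (hz.const_mul s).exp.ennreal_ofReal
  have hc : ∀ i < K + 1, ∀ ω, ∫⁻ τ, g i (ω, τ) ∂(trajLaw M.init M.trans (run.pol i ω)) ≤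
      ENNReal.ofReal (Real.exp (s ^ 2 * H ^ 2 / 2)) := by
    intro i hi ω
    rcases Nat.eq_zero_or_pos i with rfl | hi0
    · have := isProbabilityMeasure_trajLaw M.init M.trans (run.pol 0 ω)
      simp only [g, z, if_true, mul_zero, Real.exp_zero, lintegral_const, measure_univ, mul_one]
      exact ENNReal.ofReal_le_ofReal (Real.one_le_exp (by positivity))
    · simp only [g, z, hi0.ne', if_false]
      exact run.lintegral_exp_rewardDeviation_le i s ω
  have hsum : ∀ ω, ∏ i ∈ Finset.range (K + 1), g i (ω, run.traj i ω) = ENNReal.ofReal (Real.exp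
      (s * ∑ k ∈ Finset.Icc 1 K, run.rewardDeviation k (ω, run.traj k ω))) := by
    intro ω
    simp only [g]
    rw [← ENNReal.ofReal_prod_of_nonneg fun _ _ => (Real.exp_pos _).le, ← Real.exp_sum,
      ← Finset.mul_sum, Finset.sum_range_succ', ← Finset.Ico_add_one_right_eq_Icc,
      Finset.sum_Ico_eq_sum_range]
    simp [z, add_comm]
  have hF := run.measurable_prod g le_rfl hg
  refine ⟨{ω | ¬ ENNReal.ofReal (1 * Real.exp (s * (K * t))) ≤
    ∏ i ∈ Finset.range (K + 1), g i (ω, run.traj i ω)}, fun G hG => ?_, fun ω hω => ?_⟩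
  · have h1 := run.setLIntegral_prod_le g _ le_rfl hg hc hG
    rw [← ENNReal.ofReal_pow (Real.exp_pos _).le, ← Real.exp_nat_mul,
      ← one_mul (Real.exp (((K + 1 : ℕ) : ℝ) * _))] at h1
    have h2 := measure_inter_ge_le μ hF (c := 1 * Real.exp (s * (K * t))) (by positivity) h1
    rw [ofReal_mul_div_ofReal_mul_exp one_pos, ← Real.exp_add] at h2
    have h3 : G \ {ω | ¬ ENNReal.ofReal (1 * Real.exp (s * (K * t))) ≤
        ∏ i ∈ Finset.range (K + 1), g i (ω, run.traj i ω)} =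
        G ∩ {ω | ENNReal.ofReal (1 * Real.exp (s * (K * t))) ≤
          ∏ i ∈ Finset.range (K + 1), g i (ω, run.traj i ω)} := by
      ext ω; simp
    rw [h3]
    refine h2.trans ?_
    gcongr
    have h4 : s * (K * t) = K * t ^ 2 / (2 * H ^ 2) := by rw [hs]; field_simp
    have h5 : s ^ 2 * H ^ 2 / 2 = t ^ 2 / (8 * H ^ 2) := by rw [hs]; field_simp; norm_num
    rw [h4, h5]
    push_cast
    have h6 : (K + 1 : ℝ) * (t ^ 2 / (8 * H ^ 2)) ≤ (2 * K) * (t ^ 2 / (8 * H ^ 2)) := by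
      gcongr
      linarith
    have h7 : (2 * K) * (t ^ 2 / (8 * H ^ 2)) = K * t ^ 2 / (4 * (H : ℝ) ^ 2) := by
      field_simp; norm_num
    have h8 : K * t ^ 2 / (2 * (H : ℝ) ^ 2) = 2 * (K * t ^ 2 / (4 * (H : ℝ) ^ 2)) := by
      field_simp; norm_num
    linarith
  · have h1 := not_le.mp hω
    rw [hsum, one_mul, ENNReal.ofReal_lt_ofReal_iff (Real.exp_pos _), Real.exp_lt_exp] at h1
    exact (lt_of_mul_lt_mul_left h1 hs0.le).le

/-- Uniform control of the expert estimates over a finite family of rewards. -/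
theorem exists_expert_event (run : Run M πE R 𝓜 N K lam μ εP) [IsProbabilityMeasure μ]
    (hH : 1 ≤ H) (hN : 1 ≤ N) (T : Fin H → Finset (StepReward S A)) {n : ℕ}
    (hT : ∀ h, (T h).card ≤ n) {t : ℝ} (ht : 0 < t) :
    ∃ E : Set Ω, MeasurableSet[run.𝒢 0] E ∧
      μ Eᶜ ≤ ENNReal.ofReal (n * Real.exp (-(N * t ^ 2 / 2))) ∧
      ∀ ω ∈ E, ∀ q : Fin H → StepReward S A, (∀ h, q h ∈ T h) →
        (value M.init M.trans M.reward πE - value M.init M.trans q πE) -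
          (expertEst (run.expert ω) M.reward - expertEst (run.expert ω) q) ≤ H * t := by
  have hN' : (0 : ℝ) < N := by exact_mod_cast hN
  have hH' : (0 : ℝ) < H := by exact_mod_cast hH
  have hprob := isProbabilityMeasure_trajLaw M.init M.trans πE
  -- Minimizes `s² / (2N) - s t`: each step difference lies in `[-1, 1]`.
  set s : ℝ := N * t with hs
  have hs0 : 0 < s := by positivity
  let φ : Fin H → StepReward S A → Traj S A H → ℝ := fun h f τ =>
    (M.reward h).1 ((τ h).1, (τ h).2.1) - f.1 ((τ h).1, (τ h).2.1)
  have hφ : ∀ h f, Measurable (φ h f) := fun h f =>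
    (measurable_reward_step _ h).sub (measurable_reward_step _ h)
  let z : Fin H → StepReward S A → (Fin N → Traj S A H) → ℝ := fun h f D =>
    ∫ τ, φ h f τ ∂(trajLaw M.init M.trans πE) - (1 / (N : ℝ)) * ∑ j, φ h f (D j)
  have hz : ∀ h f, Measurable fun D => ENNReal.ofReal (Real.exp (s * z h f D)) := fun h f =>
    (((measurable_const.sub ((Finset.measurable_fun_sum _ fun j _ =>
      (hφ h f).comp (measurable_pi_apply j)).const_mul _)).const_mul s).exp).ennreal_ofReal
  -- Steps are treated one by one and averaged at the end. A cover of the product class would have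
  -- logarithmic size of order `H log n`; here the factor `H` cancels against the threshold.
  let F : (Fin N → Traj S A H) → ℝ≥0∞ := fun D =>
    ∑ h, ∑ f ∈ T h, ENNReal.ofReal (Real.exp (s * z h f D))
  have hF : Measurable F := Finset.measurable_fun_sum _ fun h _ =>
    Finset.measurable_fun_sum _ fun f _ => hz h f
  have hexp : Measurable run.expert := run.expert_measurable.mono (run.𝒢.le 0) le_rfl
  refine ⟨{ω | ¬ ENNReal.ofReal (H * Real.exp (s * t)) ≤ F (run.expert ω)}, ?_, ?_, ?_⟩
  · exact (run.expert_measurable (hF measurableSet_Ici)).compl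
  · have hint : ∫⁻ ω in Set.univ, F (run.expert ω) ∂μ ≤
        ENNReal.ofReal (H * (n * Real.exp (N * t ^ 2 / 2))) * μ Set.univ := by
      rw [setLIntegral_univ, measure_univ, mul_one, ← lintegral_map hF hexp, run.expert_law,
        lintegral_finsetSum _ fun h _ => Finset.measurable_fun_sum _ fun f _ => hz h f]
      calc _ ≤ ∑ h : Fin H, n • ENNReal.ofReal (Real.exp (N * t ^ 2 / 2)) :=
            Finset.sum_le_sum fun h _ => ?_
        _ = _ := by
          rw [Finset.sum_const, smul_smul, nsmul_eq_mul, ENNReal.ofReal_mul (by positivity),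
            ENNReal.ofReal_mul (by positivity)]
          simp [mul_assoc]
      rw [lintegral_finsetSum _ fun f _ => hz h f]
      calc _ ≤ ∑ f ∈ T h, ENNReal.ofReal (Real.exp (N * t ^ 2 / 2)) :=
            Finset.sum_le_sum fun f _ => ?_
        _ ≤ _ := by
          rw [Finset.sum_const]
          exact nsmul_le_nsmul_left zero_le (hT h)
      have h1 := lintegral_exp_mean_sub_empirical_le (trajLaw M.init M.trans πE) (hφ h f)
        (a := -1) (b := 1) (fun τ => by
          have h1 := (M.reward h).2.2 ((τ h).1, (τ h).2.1)
          have h2 := f.2.2 ((τ h).1, (τ h).2.1)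
          simp only [φ]
          constructor <;> linarith [h1.1, h1.2, h2.1, h2.2]) s hN
      refine h1.trans_eq ?_
      congr 2
      rw [hs]
      field_simp
      norm_num
    have h2 := measure_inter_ge_le μ (hF.comp hexp) (c := H * Real.exp (s * t)) (by positivity) hint
    rw [ofReal_mul_div_ofReal_mul_exp hH', measure_univ, mul_one, Set.univ_inter,
      mul_assoc (n : ℝ), ← Real.exp_add] at h2
    have h3 : {ω | ¬ ENNReal.ofReal (H * Real.exp (s * t)) ≤ F (run.expert ω)}ᶜ =
      {ω | ENNReal.ofReal (H * Real.exp (s * t)) ≤ (F ∘ run.expert) ω} := by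
      ext ω; simp
    rw [h3]
    refine h2.trans_eq ?_
    rw [hs]
    ring_nf
  · intro ω hω q hq
    have hle : ∑ h : Fin H, Real.exp (s * z h (q h) (run.expert ω)) ≤
        (Finset.univ : Finset (Fin H)).card * Real.exp (s * t) := by
      rw [Finset.card_univ, Fintype.card_fin, ← ENNReal.ofReal_le_ofReal_iff (by positivity),
        ENNReal.ofReal_sum_of_nonneg fun _ _ => (Real.exp_pos _).le]
      refine le_trans (Finset.sum_le_sum fun h _ => ?_) (not_le.mp hω).le
      exact Finset.single_le_sum (f := fun f => ENNReal.ofReal (Real.exp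
        (s * z h f (run.expert ω)))) (fun _ _ => zero_le) (hq h)
    have h3 := sum_le_card_mul_of_sum_exp_le _ _ _ hle
    rw [← Finset.mul_sum, Finset.card_univ, Fintype.card_fin, mul_left_comm] at h3
    have h4 := le_of_mul_le_mul_left h3 hs0
    refine le_of_eq_of_le ?_ h4
    have h5 : ∀ τ : Traj S A H, ret M.reward τ - ret q τ = ∑ h, φ h (q h) τ := fun τ => by
      rw [ret, ret, ← Finset.sum_sub_distrib]
    have hint : ∀ h, Integrable (φ h (q h)) (trajLaw M.init M.trans πE) := fun h =>
      Integrable.of_mem_Icc (-1) 1 (hφ h (q h)).aemeasurable (ae_of_all _ fun τ => by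
          have h1 := (M.reward h).2.2 ((τ h).1, (τ h).2.1)
          have h2 := (q h).2.2 ((τ h).1, (τ h).2.1)
          simp only [φ]
          constructor <;> linarith [h1.1, h1.2, h2.1, h2.2])
    rw [value_sub_eq, expertEst, expertEst, ← mul_sub, ← Finset.sum_sub_distrib]
    simp_rw [h5]
    rw [integral_finsetSum _ fun h _ => hint h, Finset.sum_comm, Finset.mul_sum,
      ← Finset.sum_sub_distrib]

end Run

end OptAIL

/-! ### Deterministic bounds on the good events -/

namespace OptAIL

theorem expertEst_le {S : Type u} {A : Type v} [MeasurableSpace S] [MeasurableSpace A] {H N : ℕ}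
    (hN : 1 ≤ N) (D : Fin N → Traj S A H) (r : Fin H → StepReward S A) : expertEst D r ≤ H := by
  have hN' : (0 : ℝ) < N := by exact_mod_cast hN
  rw [expertEst, one_div, inv_mul_le_iff₀ hN']
  calc _ ≤ ∑ _j : Fin N, (H : ℝ) := Finset.sum_le_sum fun j _ => ret_le r _
    _ = N * H := by simp

/-- The trade-off between optimism and likelihood with the regularization coefficient
`√(X / d)`. -/
theorem optimism_tradeoff {K H d L ρ ε lam X : ℝ} (hK : 1 ≤ K) (hH : 1 ≤ H) (hd : 0 < d)
    (hL : 1 / 2 ≤ L) (hε : 0 < ε) (hρ : ρ = 1 / 10000 * ε ^ 2 / (H * d + H))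
    (hX : X = K * H * L + K ^ 2 * H * ρ) (hlam : lam = Real.sqrt (X / d))
    (hKL : 10000 * ((d * H + H ^ 2) * L) / ε ^ 2 ≤ K) :
    6 * X / lam + d * lam / 4 + Real.sqrt (d * H * K) ≤ K * ε / 5 := by
  have hρ0 : 0 < ρ := by rw [hρ]; positivity
  have hX0 : 0 < X := by rw [hX]; positivity
  have hlam0 : 0 < lam := by rw [hlam]; positivity
  have hsq : lam ^ 2 = X / d := by rw [hlam]; exact Real.sq_sqrt (by positivity)
  -- The choice of `lam` makes `X / lam` equal to `d * lam`, so both terms involving `lam` are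
  -- multiples of `d * lam`.
  have hXd : X = d * lam ^ 2 := by rw [hsq]; field_simp
  have h1 : 6 * X / lam = 6 * (d * lam) := by rw [hXd]; field_simp
  rw [div_le_iff₀ (by positivity)] at hKL
  have hρ' : ρ * (H * d + H) = 1 / 10000 * ε ^ 2 := by rw [hρ]; field_simp
  have hdHL : 10000 * (d * H * L) ≤ K * ε ^ 2 := by
    nlinarith [mul_pos (pow_pos (zero_lt_one.trans_le hH) 2) (by linarith : 0 < L)]
  have hdHρ : 10000 * (d * H * ρ) ≤ ε ^ 2 := by nlinarith [mul_pos (zero_lt_one.trans_le hH) hρ0]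
  -- The two parts of `(d * lam)²`, from the likelihood and from the discretization, are each at
  -- most `(Kε)² / 10000`, and `2 / 10000 ≤ (3 / 200)²`.
  have h2 : d * lam ≤ 3 / 200 * (K * ε) := by
    refine (pow_le_pow_iff_left₀ (by positivity) (by positivity) two_ne_zero).mp ?_
    have h3 : (d * lam) ^ 2 = K * (d * H * L) + K ^ 2 * (d * H * ρ) := by
      calc (d * lam) ^ 2 = d * (d * lam ^ 2) := by ring
        _ = d * X := by rw [← hXd]
        _ = _ := by rw [hX]; ring
    rw [h3]
    nlinarith [mul_le_mul_of_nonneg_left hdHL (by linarith : 0 ≤ K),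
      mul_le_mul_of_nonneg_left hdHρ (by positivity : 0 ≤ K ^ 2),
      mul_pos (pow_pos (zero_lt_one.trans_le hK) 2) (pow_pos hε 2)]
  have h4 : Real.sqrt (d * H * K) ≤ 3 / 200 * (K * ε) := by
    rw [Real.sqrt_le_left (by positivity)]
    have h5 : 5000 * (d * H) ≤ K * ε ^ 2 := by nlinarith [mul_pos hd (zero_lt_one.trans_le hH)]
    nlinarith [mul_le_mul_of_nonneg_left h5 (by linarith : 0 ≤ K),
      mul_pos (pow_pos (zero_lt_one.trans_le hK) 2) (pow_pos hε 2)]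
  rw [h1]
  nlinarith [mul_pos (zero_lt_one.trans_le hK) hε]

namespace Run

variable {S : Type u} {A : Type v} [MeasurableSpace S] [MeasurableSpace A] {ν : Measure S}
    {H : ℕ} {M : MDP S A ν H} {πE : Policy S A H} {R : Fin H → Set (StepReward S A)}
    {𝓜 : Fin H → Set (TransitionFn S A ν)} {N K : ℕ} {lam : ℝ}
    {Ω : Type w} [mΩ : MeasurableSpace Ω] {μ : Measure Ω} {εP : Ω → ℝ}

/-- The model `P^1` is compared with itself. This is informative only for a finite loss, which the
comparison with the true model provides. -/
theorem model_error_nonneg (run : Run M πE R 𝓜 N K lam μ εP) (hM : ∀ h, M.trans h ∈ 𝓜 h)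
    (hK : 1 ≤ K) {ω : Ω} (hpos : ∀ i ≤ K, ∀ h, 0 < stepDensity (M.trans h) h (run.traj i ω)) :
    0 ≤ εP ω := by
  have h1 : 1 ∈ Finset.Icc 1 K := Finset.mem_Icc.mpr ⟨le_rfl, hK⟩
  obtain ⟨hQ, -⟩ := modelLoss_le_real (fun i hi h => hpos i (by omega) h)
    (run.model_opt 1 h1 ω M.trans hM)
  obtain ⟨-, h2⟩ := modelLoss_le_real hQ
    (run.model_opt 1 h1 ω (run.model 1 ω) (run.model_mem 1 h1 ω))
  simpa using h2

/-- Near-optimality of `P^k` against the true model bounds the optimism deficit by a log-likelihood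
ratio. Passing to the cover costs `ρ` in the logarithm and `ρ` in the Hellinger error for each past
trajectory and step, whence `2 K² H ρ`. -/
theorem sum_optimism_le (run : Run M πE R 𝓜 N K lam μ εP) (hM : ∀ h, M.trans h ∈ 𝓜 h)
    {ρ B : ℝ} (hρ : 0 ≤ ρ) {T : Fin H → Finset (TransitionFn S A ν)}
    (hT : ∀ h, ∀ f ∈ 𝓜 h, ∃ f' ∈ T h, LogClose ρ f f') {ω : Ω}
    (hpos : ∀ i ≤ K, ∀ h, 0 < stepDensity (M.trans h) h (run.traj i ω))
    (hB : ∀ Q : ℕ → Fin H → TransitionFn S A ν, (∀ k ∈ Finset.Icc 1 K, ∀ h, Q k h ∈ T h) →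
        (∀ k ∈ Finset.Icc 1 K, ∀ i < k, ∀ h, 0 < stepDensity (Q k h) h (run.traj i ω)) →
        ∑ k ∈ Finset.Icc 1 K, ∑ h, ∑ i ∈ Finset.range k,
          (Real.log (stepDensity (Q k h) h (run.traj i ω)) -
            Real.log (stepDensity (M.trans h) h (run.traj i ω)) +
            hellingerError M h (Q k h) (run.pol i ω)) ≤ B) :
    lam * ∑ k ∈ Finset.Icc 1 K, (optValue M.init M.trans (run.rew k ω) -
        optValue M.init (run.model k ω) (run.rew k ω)) ≤
      K * εP ω + B + 2 * (K ^ 2 * H * ρ) - ∑ k ∈ Finset.Icc 1 K, ∑ i ∈ Finset.Ico 1 k,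
        ∫ τ, ∑ h, hellingerSq (M.trans h) (run.model k ω h) ((τ h).1, (τ h).2.1)
          ∂(trajLaw M.init M.trans (run.pol i ω)) := by
  have hex : ∀ k h, ∃ q, k ∈ Finset.Icc 1 K → q ∈ T h ∧ LogClose ρ (run.model k ω h) q := by
    intro k h
    by_cases hk : k ∈ Finset.Icc 1 K
    · obtain ⟨q, hq⟩ := hT h _ (run.model_mem k hk ω h)
      exact ⟨q, fun _ => hq⟩
    · exact ⟨M.trans h, fun hk' => absurd hk' hk⟩
  choose Q hQ using hex
  have hopt : ∀ k ∈ Finset.Icc 1 K, _ := fun k hk => modelLoss_le_real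
    (fun i hi h => hpos i (by have := (Finset.mem_Icc.mp hk).2; omega) h)
    (run.model_opt k hk ω M.trans hM)
  have hlog : ∀ k ∈ Finset.Icc 1 K, ∀ i < k, ∀ h, _ := fun k hk i hi h =>
    (hQ k h hk).2.log_le ((hopt k hk).1 i hi h)
  have hB' := hB Q (fun k hk h => (hQ k h hk).1) fun k hk i hi h => (hlog k hk i hi h).1
  have hstep : ∀ k ∈ Finset.Icc 1 K, lam * (optValue M.init M.trans (run.rew k ω) -
        optValue M.init (run.model k ω) (run.rew k ω)) ≤
      εP ω + ∑ h, ∑ i ∈ Finset.range k,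
          (Real.log (stepDensity (Q k h) h (run.traj i ω)) -
            Real.log (stepDensity (M.trans h) h (run.traj i ω)) +
            hellingerError M h (Q k h) (run.pol i ω)) + 2 * (K * H * ρ) -
        ∑ i ∈ Finset.Ico 1 k, ∑ h, hellingerError M h (run.model k ω h) (run.pol i ω) := by
    intro k hk
    have hkK : (k : ℝ) ≤ K := by exact_mod_cast (Finset.mem_Icc.mp hk).2
    have h1 : ∑ i ∈ Finset.range k, ∑ h,
        (Real.log (stepDensity (run.model k ω h) h (run.traj i ω)) -
          Real.log (stepDensity (M.trans h) h (run.traj i ω))) ≤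
        ∑ i ∈ Finset.range k, ∑ h, ((Real.log (stepDensity (Q k h) h (run.traj i ω)) -
            Real.log (stepDensity (M.trans h) h (run.traj i ω)) +
            hellingerError M h (Q k h) (run.pol i ω)) + 2 * ρ -
            hellingerError M h (run.model k ω h) (run.pol i ω)) := by
      refine Finset.sum_le_sum fun i hi => Finset.sum_le_sum fun h _ => ?_
      have h2 := (hlog k hk i (Finset.mem_range.mp hi) h).2
      have h3 := hellingerError_le_of_logClose M h hρ (hQ k h hk).2 (run.pol i ω)
      linarith
    simp_rw [Finset.sum_sub_distrib (f := fun h => (Real.log (stepDensity (Q k h) h _) - _ + _) + _),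
      Finset.sum_add_distrib (g := fun _ => 2 * ρ)] at h1
    rw [Finset.sum_sub_distrib, Finset.sum_add_distrib, Finset.sum_comm (s := Finset.range k)
      (f := fun i h => Real.log (stepDensity (Q k h) h (run.traj i ω)) - _ + _)] at h1
    -- The likelihood includes `τ^0`, while the eluder inequality starts at `π^1`; the nonnegative
    -- term `i = 0` is dropped.
    have h4 : ∑ i ∈ Finset.Ico 1 k, ∑ h, hellingerError M h (run.model k ω h) (run.pol i ω) ≤
        ∑ i ∈ Finset.range k, ∑ h, hellingerError M h (run.model k ω h) (run.pol i ω) :=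
      Finset.sum_le_sum_of_subset_of_nonneg
        (fun i hi => Finset.mem_range.mpr (Finset.mem_Ico.mp hi).2)
        fun i _ _ => Finset.sum_nonneg fun h _ => hellingerError_nonneg _ _ _ _
    have h5 : ∑ _i ∈ Finset.range k, ∑ _h : Fin H, 2 * ρ ≤ 2 * (K * H * ρ) := by
      simp only [Finset.sum_const, Finset.card_univ, Fintype.card_fin, Finset.card_range,
        nsmul_eq_mul]
      have : (k : ℝ) * (H * ρ) ≤ K * (H * ρ) := by gcongr
      linarith
    linarith [(hopt k hk).2]
  have hsum := Finset.sum_le_sum hstep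
  rw [← Finset.mul_sum] at hsum
  refine hsum.trans ?_
  rw [Finset.sum_sub_distrib, Finset.sum_add_distrib, Finset.sum_add_distrib]
  simp only [Finset.sum_const, Nat.card_Icc, Nat.add_sub_cancel, nsmul_eq_mul, sum_hellingerError]
  linarith

/-- The suboptimality of the policies `π^k` for the rewards `r^k`, once the likelihoods are
controlled. -/
theorem sum_value_gap_le (run : Run M πE R 𝓜 N K lam μ εP) (hM : ∀ h, M.trans h ∈ 𝓜 h)
    (hH : 1 ≤ H) (hK : 1 ≤ K) {ε d ρ L X : ℝ} (hε : 0 < ε) (hd : 0 < d) (hL : 1 / 2 ≤ L)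
    (hgec : gec M R 𝓜 K (ε / (2 * H)) ≤ ENNReal.ofReal d)
    (hρ : ρ = 1 / 10000 * ε ^ 2 / (H * d + H)) (hX : X = K * H * L + K ^ 2 * H * ρ)
    (hlam : lam = Real.sqrt (X / d)) (hKL : 10000 * ((d * H + H ^ 2) * L) / ε ^ 2 ≤ K)
    {T : Fin H → Finset (TransitionFn S A ν)}
    (hT : ∀ h, ∀ f ∈ 𝓜 h, ∃ f' ∈ T h, LogClose ρ f f') {ω : Ω}
    (hpos : ∀ i ≤ K, ∀ h, 0 < stepDensity (M.trans h) h (run.traj i ω))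
    (hB : ∀ Q : ℕ → Fin H → TransitionFn S A ν, (∀ k ∈ Finset.Icc 1 K, ∀ h, Q k h ∈ T h) →
        (∀ k ∈ Finset.Icc 1 K, ∀ i < k, ∀ h, 0 < stepDensity (Q k h) h (run.traj i ω)) →
        ∑ k ∈ Finset.Icc 1 K, ∑ h, ∑ i ∈ Finset.range k,
          (Real.log (stepDensity (Q k h) h (run.traj i ω)) -
            Real.log (stepDensity (M.trans h) h (run.traj i ω)) +
            hellingerError M h (Q k h) (run.pol i ω)) ≤ 2 * (K * H * (3 * L))) :
    ∑ k ∈ Finset.Icc 1 K, (value M.init M.trans (run.rew k ω) πE -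
        value M.init M.trans (run.rew k ω) (run.pol k ω)) ≤
      K * (εP ω / lam) + 7 / 10 * (K * ε) := by
  have hK' : (1 : ℝ) ≤ K := by exact_mod_cast hK
  have hH' : (1 : ℝ) ≤ H := by exact_mod_cast hH
  have hρ0 : 0 < ρ := by rw [hρ]; positivity
  have hX0 : 0 < X := by rw [hX]; positivity
  have hlam0 : 0 < lam := by rw [hlam]; positivity
  have h1 := run.sum_optimism_le hM hρ0.le hT hpos hB
  -- The weight `2 / lam` gives the Hellinger sum the coefficient `1 / lam`, which cancels the
  -- negative term of `h1`.
  have h2 := isGECBound_of_gec_le hd.le hgec (fun k => run.rew k ω) (fun k => run.model k ω)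
    (fun k => run.pol k ω)
    (fun k hk => ⟨run.rew_mem k hk ω, run.model_mem k hk ω, run.pol_opt k hk ω⟩)
    (2 / lam) (by positivity)
  have h3 := optimism_tradeoff hK' hH' hd hL hε hρ hX hlam hKL
  set D := ∑ k ∈ Finset.Icc 1 K, ∑ i ∈ Finset.Ico 1 k,
        ∫ τ, ∑ h, hellingerSq (M.trans h) (run.model k ω h) ((τ h).1, (τ h).2.1)
          ∂(trajLaw M.init M.trans (run.pol i ω))
  rw [mul_comm lam, ← le_div_iff₀ hlam0] at h1
  have h4 : ∑ k ∈ Finset.Icc 1 K, (value M.init M.trans (run.rew k ω) πE -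
        value M.init M.trans (run.rew k ω) (run.pol k ω)) ≤
      ∑ k ∈ Finset.Icc 1 K, (optValue M.init M.trans (run.rew k ω) -
        optValue M.init (run.model k ω) (run.rew k ω)) +
      ∑ k ∈ Finset.Icc 1 K, (optValue M.init (run.model k ω) (run.rew k ω) -
        value M.init M.trans (run.rew k ω) (run.pol k ω)) := by
    rw [← Finset.sum_add_distrib]
    refine Finset.sum_le_sum fun k _ => ?_
    linarith [value_le_optValue M.init M.trans (run.rew k ω) πE]
  have h5 : (K * εP ω + 2 * (K * H * (3 * L)) + 2 * (K ^ 2 * H * ρ) - D) / lam ≤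
      K * (εP ω / lam) + 6 * X / lam - D / lam := by
    rw [← mul_div_assoc, ← add_div, ← sub_div]
    refine div_le_div_of_nonneg_right ?_ hlam0.le
    rw [hX]
    nlinarith [mul_pos (mul_pos (pow_pos (zero_lt_one.trans_le hK') 2) (zero_lt_one.trans_le hH'))
      hρ0]
  have h6 : 2 / lam / 2 * D = D / lam := by field_simp
  have h7 : d / (2 * (2 / lam)) = d * lam / 4 := by field_simp; norm_num
  have h8 : ε / (2 * H) * H * K = K * ε / 2 := by field_simp
  rw [h6, h7, h8] at h2
  linarith

/-- An optimal policy of the model is optimal in the true MDP, because the two have the same values.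
-/
theorem sum_value_gap_le_of_horizon_one (run : Run M πE R 𝓜 N K lam μ εP) (hH : H = 1) (ω : Ω) :
    ∑ k ∈ Finset.Icc 1 K, (value M.init M.trans (run.rew k ω) πE -
        value M.init M.trans (run.rew k ω) (run.pol k ω)) ≤ 0 := by
  refine Finset.sum_nonpos fun k hk => ?_
  have h := run.pol_opt k hk ω πE
  rw [value_eq_of_horizon_one hH M.init (run.model k ω) M.trans,
    value_eq_of_horizon_one hH M.init (run.model k ω) M.trans] at h
  linarith

theorem imitationGap_le (run : Run M πE R 𝓜 N K lam μ εP) (hR : ∀ h, M.reward h ∈ R h)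
    (hN : 1 ≤ N) (hK : 1 ≤ K) {ω : Ω} {a b c : ℝ}
    (ha : ∀ k ∈ Finset.Icc 1 K,
      (value M.init M.trans M.reward πE - value M.init M.trans (run.rew k ω) πE) -
          (expertEst (run.expert ω) M.reward - expertEst (run.expert ω) (run.rew k ω)) ≤ a)
    (hb : ∑ k ∈ Finset.Icc 1 K, run.rewardDeviation k (ω, run.traj k ω) ≤ K * b)
    (hc : ∑ k ∈ Finset.Icc 1 K, (value M.init M.trans (run.rew k ω) πE -
        value M.init M.trans (run.rew k ω) (run.pol k ω)) ≤ K * c) :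
    run.imitationGap ω ≤ a + b + run.rewardOptError ω + c := by
  have hK' : (0 : ℝ) < K := by exact_mod_cast hK
  have hopt : ∑ k ∈ Finset.Icc 1 K,
      ((ret (run.rew k ω) (run.traj k ω) - expertEst (run.expert ω) (run.rew k ω))
        - (ret M.reward (run.traj k ω) - expertEst (run.expert ω) M.reward)) ≤
      K * run.rewardOptError ω := by
    rw [rewardOptError, ← mul_assoc, mul_one_div_cancel hK'.ne', one_mul]
    refine le_ciSup (f := fun r : {r : Fin H → StepReward S A // ∀ h, r h ∈ R h} =>
      ∑ k ∈ Finset.Icc 1 K,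
      ((ret (run.rew k ω) (run.traj k ω) - expertEst (run.expert ω) (run.rew k ω))
        - (ret r.1 (run.traj k ω) - expertEst (run.expert ω) r.1))) ?_ ⟨M.reward, hR⟩
    -- Boundedness is needed for the real supremum to be meaningful: returns are nonnegative and
    -- expert estimates are at most `H`.
    refine ⟨∑ k ∈ Finset.Icc 1 K,
      (ret (run.rew k ω) (run.traj k ω) - expertEst (run.expert ω) (run.rew k ω) + H), ?_⟩
    rintro _ ⟨r, rfl⟩
    refine Finset.sum_le_sum fun k _ => ?_
    linarith [ret_nonneg r.1 (run.traj k ω), expertEst_le hN (run.expert ω) r.1]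
  have hsum := Finset.sum_le_sum ha
  have hgap : K * run.imitationGap ω = ∑ k ∈ Finset.Icc 1 K,
      (value M.init M.trans M.reward πE - value M.init M.trans M.reward (run.pol k ω)) := by
    rw [imitationGap, outputValue, ← Finset.mul_sum, Finset.sum_sub_distrib]
    simp only [Finset.sum_const, Nat.card_Icc, Nat.add_sub_cancel, nsmul_eq_mul]
    field_simp
  simp only [Finset.sum_const, Nat.card_Icc, Nat.add_sub_cancel, nsmul_eq_mul] at hsum
  refine le_of_mul_le_mul_left ?_ hK'
  rw [hgap]
  have hdec : ∑ k ∈ Finset.Icc 1 K,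
      (value M.init M.trans M.reward πE - value M.init M.trans M.reward (run.pol k ω)) =
      ∑ k ∈ Finset.Icc 1 K,
        ((value M.init M.trans M.reward πE - value M.init M.trans (run.rew k ω) πE) -
          (expertEst (run.expert ω) M.reward - expertEst (run.expert ω) (run.rew k ω))) +
      ∑ k ∈ Finset.Icc 1 K, run.rewardDeviation k (ω, run.traj k ω) +
      ∑ k ∈ Finset.Icc 1 K,
      ((ret (run.rew k ω) (run.traj k ω) - expertEst (run.expert ω) (run.rew k ω))
        - (ret M.reward (run.traj k ω) - expertEst (run.expert ω) M.reward)) +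
      ∑ k ∈ Finset.Icc 1 K, (value M.init M.trans (run.rew k ω) πE -
        value M.init M.trans (run.rew k ω) (run.pol k ω)) := by
    rw [← Finset.sum_add_distrib, ← Finset.sum_add_distrib, ← Finset.sum_add_distrib]
    refine Finset.sum_congr rfl fun k _ => ?_
    rw [rewardDeviation]
    ring
  rw [hdec]
  linarith

end Run

end OptAIL

/-! ### Constants and combination of the events -/

namespace OptAIL

theorem exp_neg_le_of_log_le {x y δ : ℝ} (hy : 0 < y) (hδ : 0 < δ)
    (h : 3 * Real.log (y / δ) ≤ x) : Real.exp (-x) ≤ (δ / y) ^ 3 := by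
  have h1 : (δ / y) ^ 3 = Real.exp (-(3 * Real.log (y / δ))) := by
    rw [← inv_div y δ, ← Real.exp_log (show 0 < (y / δ)⁻¹ by positivity), ← Real.exp_nat_mul,
      Real.log_inv]
    congr 1
    push_cast
    ring
  rw [h1, Real.exp_le_exp]
  linarith

theorem RewardClose.trans_symm {S : Type u} {A : Type v} [MeasurableSpace S] [MeasurableSpace A]
    {ρ : ℝ} {f g q : StepReward S A} (hf : RewardClose ρ f q) (hg : RewardClose ρ g q) :
    RewardClose (2 * ρ) f g := fun x => by
  have h1 := abs_le.mp (hf x)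
  have h2 := abs_le.mp (hg x)
  rw [abs_le]
  constructor <;> linarith [h1.1, h1.2, h2.1, h2.2]

/-- If `E₀` is likely and `E` is very likely given every event of the initial information, then both
hold with probability at least `1 - δ`. -/
theorem measure_compl_union_diff_le {Ω : Type*} [MeasurableSpace Ω] (μ : Measure Ω)
    [IsProbabilityMeasure μ] {E₀ E : Set Ω} (hE₀ : MeasurableSet E₀) {δ : ℝ} (hδ : 0 < δ)
    (hδ1 : δ ≤ 1) (h₀ : μ E₀ᶜ ≤ ENNReal.ofReal (δ / 2))
    (h : μ (E₀ \ E) ≤ ENNReal.ofReal (δ ^ 2) * μ E₀) :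
    μ (E₀ᶜ ∪ E₀ \ E) ≤ ENNReal.ofReal δ := by
  have h1 : μ E₀ᶜ = ENNReal.ofReal (μ.real E₀ᶜ) := by simp
  have h2 : μ E₀ = ENNReal.ofReal (1 - μ.real E₀ᶜ) := by
    rw [probReal_compl_eq_one_sub hE₀]
    simp
  have hp0 : 0 ≤ μ.real E₀ᶜ := measureReal_nonneg
  have hp : μ.real E₀ᶜ ≤ δ / 2 := by
    rwa [h1, ENNReal.ofReal_le_ofReal_iff (by positivity)] at h₀
  refine (measure_union_le _ _).trans ((add_le_add_right h _).trans ?_)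
  rw [h1, h2, ← ENNReal.ofReal_mul (by positivity),
    ← ENNReal.ofReal_add hp0 (mul_nonneg (by positivity) (by linarith))]
  refine ENNReal.ofReal_le_ofReal ?_
  -- The bound increases with the probability of `E₀ᶜ`, so `δ / 2` is the worst case; what remains
  -- is `δ (1 - δ)² ≥ 0`.
  have h3 : μ.real E₀ᶜ * (1 - δ ^ 2) ≤ δ / 2 * (1 - δ ^ 2) :=
    mul_le_mul_of_nonneg_right hp (by nlinarith)
  nlinarith [mul_nonneg hδ.le (sq_nonneg (1 - δ))]

namespace Run

variable {S : Type u} {A : Type v} [MeasurableSpace S] [MeasurableSpace A] {ν : Measure S}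
    {H : ℕ} {M : MDP S A ν H} {πE : Policy S A H} {R : Fin H → Set (StepReward S A)}
    {𝓜 : Fin H → Set (TransitionFn S A ν)} {N K : ℕ} {lam : ℝ}
    {Ω : Type w} [mΩ : MeasurableSpace Ω] {μ : Measure Ω} {εP : Ω → ℝ}

theorem exists_expert_class_event (run : Run M πE R 𝓜 N K lam μ εP) [IsProbabilityMeasure μ]
    (hR : ∀ h, M.reward h ∈ R h) (hH : 1 ≤ H) (hN : 1 ≤ N) {ε δ ρ : ℝ} (hε : 0 < ε) (hδ : 0 < δ)
    (hδ1 : δ ≤ 1) (hρ : 0 ≤ ρ) {T : Fin H → Finset (StepReward S A)} {n : ℕ}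
    (hT : ∀ h, ∀ f ∈ R h, ∃ f' ∈ T h, RewardClose ρ f f') (hcard : ∀ h, (T h).card ≤ n)
    (hNn : 10000 * (H ^ 2 * Real.log (n / δ)) / ε ^ 2 ≤ N) :
    ∃ E : Set Ω, MeasurableSet[run.𝒢 0] E ∧ μ Eᶜ ≤ ENNReal.ofReal (δ / 2) ∧
      ∀ ω ∈ E, ∀ r : Fin H → StepReward S A, (∀ h, r h ∈ R h) →
        (value M.init M.trans M.reward πE - value M.init M.trans r πE) -
          (expertEst (run.expert ω) M.reward - expertEst (run.expert ω) r) ≤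
        ε / 10 + 4 * (H * ρ) := by
  have hH' : (0 : ℝ) < H := by exact_mod_cast hH
  -- For `n = 1` and `δ = 1` the sample-size condition is void. With at most one covering element,
  -- however, all rewards of the class lie within `2ρ` of each other and no concentration is needed.
  rcases Nat.lt_or_ge n 2 with hn | hn
  · refine ⟨Set.univ, MeasurableSet.univ, by simp, fun ω _ r hr => ?_⟩
    have hc : ∀ h, RewardClose (2 * ρ) (M.reward h) (r h) := fun h => by
      obtain ⟨q, hq, hq'⟩ := hT h _ (hR h)
      obtain ⟨p, hp, hp'⟩ := hT h _ (hr h)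
      rw [Finset.card_le_one.mp ((hcard h).trans (by omega)) p hp q hq] at hp'
      exact hq'.trans_symm hp'
    have h1 := abs_le.mp (abs_value_sub_le hc M.init M.trans πE)
    have h2 := abs_le.mp (abs_expertEst_sub_le hc hN (run.expert ω))
    linarith [h1.2, h2.1]
  · have hn' : (2 : ℝ) ≤ n := by exact_mod_cast hn
    obtain ⟨E, hE, hEp, hEb⟩ := run.exists_expert_event hH hN T hcard (t := ε / (10 * H))
      (by positivity)
    refine ⟨E, hE, hEp.trans (ENNReal.ofReal_le_ofReal ?_), fun ω hω r hr => ?_⟩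
    · have hlog : 0 ≤ Real.log (n / δ) :=
        Real.log_nonneg ((one_le_div hδ).mpr (by linarith))
      rw [div_le_iff₀ (by positivity)] at hNn
      have h1 : Real.exp (-(N * (ε / (10 * H)) ^ 2 / 2)) ≤ (δ / n) ^ 3 := by
        refine exp_neg_le_of_log_le (by linarith) hδ ?_
        have h2 : N * (ε / (10 * H)) ^ 2 / 2 = N * ε ^ 2 / (200 * (H : ℝ) ^ 2) := by
          field_simp; norm_num
        rw [h2, le_div_iff₀ (by positivity)]
        nlinarith [mul_nonneg (sq_nonneg (H : ℝ)) hlog]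
      calc n * Real.exp (-(N * (ε / (10 * H)) ^ 2 / 2)) ≤ n * (δ / n) ^ 3 := by gcongr
        _ = δ * (δ ^ 2 / n ^ 2) := by field_simp
        _ ≤ δ * (1 / 2 ^ 2) := by
          gcongr
          exact pow_le_one₀ hδ.le hδ1
        _ ≤ δ / 2 := by linarith
    · choose q hq using fun h => hT h (r h) (hr h)
      have h0 := hEb ω hω q fun h => (hq h).1
      have h1 := abs_le.mp (abs_value_sub_le (fun h => (hq h).2) M.init M.trans πE)
      have h2 := abs_le.mp (abs_expertEst_sub_le (fun h => (hq h).2) hN (run.expert ω))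
      have h3 : H * (ε / (10 * H)) = ε / 10 := by field_simp
      have h4 : 0 ≤ H * ρ := by positivity
      linarith [h1.1, h2.2]

/-- The failure bound holds relative to every event of `𝒢 0`, so that it can be applied on the good
event of the expert data. -/
theorem exists_interaction_event (run : Run M πE R 𝓜 N K lam μ εP) [IsProbabilityMeasure μ]
    (hM : ∀ h, M.trans h ∈ 𝓜 h) (hH : 1 ≤ H) (hK : 1 ≤ K) {ε δ d ρ : ℝ} (hε : 0 < ε)
    (hδ : 0 < δ) (hδ1 : δ ≤ 1) (hd : 0 < d)
    (hgec : gec M R 𝓜 K (ε / (2 * H)) ≤ ENNReal.ofReal d)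
    (hρ : ρ = 1 / 10000 * ε ^ 2 / (H * d + H)) {T : Fin H → Finset (TransitionFn S A ν)} {n : ℕ}
    (hT : ∀ h, ∀ f ∈ 𝓜 h, ∃ f' ∈ T h, LogClose ρ f f') (hcard : ∀ h, (T h).card ≤ n)
    (hlam : lam = Real.sqrt ((K * H * Real.log (H * n / δ) + K ^ 2 * H * ρ) / d))
    (hKn : 10000 * ((d * H + H ^ 2) * Real.log (H * n / δ)) / ε ^ 2 ≤ K) :
    ∃ E : Set Ω, (∀ G, MeasurableSet[run.𝒢 0] G → μ (G \ E) ≤ ENNReal.ofReal (δ ^ 2) * μ G) ∧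
      ∀ ω ∈ E, (∀ i ≤ K, ∀ h, 0 < stepDensity (M.trans h) h (run.traj i ω)) →
        ∑ k ∈ Finset.Icc 1 K, run.rewardDeviation k (ω, run.traj k ω) ≤ K * (ε / 10) ∧
        ∑ k ∈ Finset.Icc 1 K, (value M.init M.trans (run.rew k ω) πE -
          value M.init M.trans (run.rew k ω) (run.pol k ω)) ≤
            K * (εP ω / lam + 7 / 10 * ε) := by
  have hH' : (1 : ℝ) ≤ H := by exact_mod_cast hH
  have hn : 1 ≤ n := by
    obtain ⟨q, hq, -⟩ := hT ⟨0, hH⟩ _ (hM _)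
    exact le_trans (Finset.card_pos.mpr ⟨q, hq⟩) (hcard _)
  have hn' : (1 : ℝ) ≤ n := by exact_mod_cast hn
  have hHn : (H : ℝ) ≤ H * n := le_mul_of_one_le_right (by linarith) hn'
  have hHδ : (H : ℝ) ≤ H * n / δ := hHn.trans (le_div_self (by positivity) hδ hδ1)
  set L := Real.log (H * n / δ) with hLdef
  have hL0 : 0 ≤ L := Real.log_nonneg (hH'.trans hHδ)
  obtain ⟨E₁, hE₁, hE₁b⟩ := run.exists_reward_event hH hK (t := ε / 10) (by positivity)
  have hq₁ : Real.exp (-(K * (ε / 10) ^ 2 / (4 * H ^ 2))) ≤ (δ / (H * n)) ^ 3 := by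
    refine exp_neg_le_of_log_le (by positivity) hδ ?_
    rw [div_le_iff₀ (by positivity)] at hKn
    rw [le_div_iff₀ (by positivity), ← hLdef]
    nlinarith [mul_nonneg (sq_nonneg (H : ℝ)) hL0, mul_nonneg (mul_nonneg hd.le (by linarith :
      (0 : ℝ) ≤ H)) hL0]
  -- The cube leaves room for the size `n` of the cover and for a factor `H³`, which is at least `8`
  -- when `H ≥ 2` and so absorbs the union of two events.
  have hδn : (δ / (H * n)) ^ 3 * (n * H ^ 3) ≤ δ ^ 3 := by
    have h1 : (δ / (H * n)) ^ 3 * (n * H ^ 3) = δ ^ 3 / n ^ 2 := by field_simp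
    rw [h1]
    exact div_le_self (by positivity) (one_le_pow₀ hn')
  have hδ3 : δ ^ 3 ≤ δ ^ 2 := pow_le_pow_of_le_one hδ.le hδ1 (by norm_num)
  set x := (δ / (H * n)) ^ 3
  have hx0 : 0 ≤ x := by positivity
  -- The trade-off needs `L ≥ 1/2`, which `L ≥ log 2` gives for `H ≥ 2`. For `H = 1` the logarithm
  -- may vanish, but then planning is exact.
  rcases Nat.lt_or_ge H 2 with hH2 | hH2
  · have hH1 : H = 1 := by omega
    refine ⟨E₁, fun G hG => (hE₁ G hG).trans ?_, fun ω hω hpos => ⟨hE₁b ω hω, ?_⟩⟩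
    · gcongr
      refine hq₁.trans (le_trans ?_ (hδn.trans hδ3))
      exact le_mul_of_one_le_right hx0 (one_le_mul_of_one_le_of_one_le hn' (one_le_pow₀ hH'))
    · refine (run.sum_value_gap_le_of_horizon_one hH1 ω).trans ?_
      have h1 := run.model_error_nonneg hM hK hpos
      have h2 : 0 ≤ lam := by rw [hlam]; positivity
      positivity
  · have hH2' : (2 : ℝ) ≤ H := by exact_mod_cast hH2
    have hL : 1 / 2 ≤ L := by
      have h1 : Real.log 2 ≤ L := Real.log_le_log two_pos (hH2'.trans hHδ)
      linarith [Real.log_two_gt_d9]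
    obtain ⟨E₂, hE₂, hE₂b⟩ := run.exists_model_event hH hK T hcard (3 * L)
    have hq₂ : Real.exp (-(3 * L)) ≤ x := exp_neg_le_of_log_le (by positivity) hδ le_rfl
    refine ⟨E₁ ∩ E₂, fun G hG => ?_, fun ω hω hpos => ⟨hE₁b ω hω.1, ?_⟩⟩
    · rw [Set.sdiff_inter]
      refine (measure_union_le _ _).trans ((add_le_add (hE₁ G hG) (hE₂ G hG)).trans ?_)
      rw [← add_mul, ← ENNReal.ofReal_add (by positivity) (by positivity)]
      gcongr
      have h8 : (2 : ℝ) ^ 3 ≤ (H : ℝ) ^ 3 := by gcongr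
      have h9 : x * (n * 2 ^ 3) ≤ x * (n * H ^ 3) := by gcongr
      have h10 : x * 1 ≤ x * n := by gcongr
      have h11 : n * Real.exp (-(3 * L)) ≤ n * x := by gcongr
      nlinarith
    · have h := run.sum_value_gap_le hM hH hK hε hd hL hgec hρ rfl hlam hKn hT hpos
        (hE₂b ω hω.2 hpos)
      linarith

end Run

end OptAIL

theorem mainTheorem2 :
    ∃ c₁ c₂ C : ℝ, 0 < c₁ ∧ 0 < c₂ ∧ 0 < C ∧
      ∀ (S : Type u) (A : Type v) [MeasurableSpace S] [MeasurableSpace A] (ν : Measure S)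
        (H : ℕ) (_ : 1 ≤ H) (M : OptAIL.MDP S A ν H) (πE : OptAIL.Policy S A H)
        (R : Fin H → Set (OptAIL.StepReward S A)) (𝓜 : Fin H → Set (OptAIL.TransitionFn S A ν))
        (_ : ∀ h, M.reward h ∈ R h) (_ : ∀ h, M.trans h ∈ 𝓜 h)
        (N K : ℕ) (_ : 1 ≤ N) (_ : 1 ≤ K)
        (ε δ d ρ lam : ℝ) (_ : 0 < ε) (_ : ε ≤ 1) (_ : 0 < δ) (_ : δ ≤ 1)
        (_ : 0 < d) (_ : OptAIL.gec M R 𝓜 K (ε / (2 * H)) ≤ ENNReal.ofReal d)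
        (_ : ρ = c₂ * ε ^ 2 / (H * d + H))
        (_ : OptAIL.maxRewardCover R ρ ≠ ⊤) (_ : OptAIL.maxModelCover 𝓜 ρ ≠ ⊤)
        (_ : lam = c₁ * Real.sqrt
          ((K * H * Real.log (H * (OptAIL.maxModelCover 𝓜 ρ).toNat / δ) + K ^ 2 * H * ρ) / d))
        (_ : C * (H ^ 2 * Real.log ((OptAIL.maxRewardCover R ρ).toNat / δ)) / ε ^ 2 ≤ N)
        (_ : C * ((d * H + H ^ 2) * Real.log (H * (OptAIL.maxModelCover 𝓜 ρ).toNat / δ)) / ε ^ 2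
          ≤ K)
        (Ω : Type w) [MeasurableSpace Ω] (μ : Measure Ω) [IsProbabilityMeasure μ] (εP : Ω → ℝ)
        (run : OptAIL.Run M πE R 𝓜 N K lam μ εP),
        μ {ω | ¬ run.imitationGap ω ≤ ε + run.rewardOptError ω + εP ω / lam} ≤
          ENNReal.ofReal δ := by
  refine ⟨1, 1 / 10000, 10000, one_pos, by norm_num, by norm_num, ?_⟩
  intro S A _ _ ν H hH M πE R 𝓜 hR hM N K hN hK ε δ d ρ lam hε hε1 hδ hδ1 hd hgec hρ hcR hcM hlam
    hNn hKn Ω _ μ _ εP run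
  have hH' : (1 : ℝ) ≤ H := by exact_mod_cast hH
  have hρ0 : 0 < ρ := by rw [hρ]; positivity
  have hHρ : 10000 * (H * ρ) ≤ ε := by
    have h1 : ρ * (H * d + H) = 1 / 10000 * ε ^ 2 := by rw [hρ]; field_simp
    nlinarith [mul_pos (mul_pos (zero_lt_one.trans_le hH') hd) hρ0]
  rw [one_mul] at hlam
  obtain ⟨TR, hTR⟩ := OptAIL.exists_covers_of_iSup_ne_top hcR
  obtain ⟨TM, hTM⟩ := OptAIL.exists_covers_of_iSup_ne_top hcM
  obtain ⟨E₀, hE₀, hE₀p, hE₀b⟩ := run.exists_expert_class_event hR hH hN hε hδ hδ1 hρ0.le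
    (fun h => (hTR h).2.1) (fun h => (hTR h).2.2) hNn
  obtain ⟨E, hEp, hEb⟩ := run.exists_interaction_event hM hH hK hε hδ hδ1 hd hgec hρ
    (fun h => (hTM h).2.1) (fun h => (hTM h).2.2) hlam hKn
  -- An almost-sure inclusion suffices, and the bad event need not be measurable.
  refine le_trans (measure_mono_ae ?_) (OptAIL.measure_compl_union_diff_le μ (run.𝒢.le 0 _ hE₀) hδ
    hδ1 hE₀p (hEp E₀ hE₀))
  filter_upwards [run.ae_stepDensity_pos] with ω hpos hbad
  by_contra hmem
  have hω₀ : ω ∈ E₀ := by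
    by_contra h
    exact hmem (Or.inl h)
  have hω : ω ∈ E := by
    by_contra h
    exact hmem (Or.inr ⟨hω₀, h⟩)
  obtain ⟨hb, hc⟩ := hEb ω hω hpos
  refine hbad ((run.imitationGap_le hR hN hK
    (fun k hk => hE₀b ω hω₀ _ (run.rew_mem k hk ω)) hb hc).trans ?_)
  -- The contributions are `ε/10 + 4Hρ` from the expert, `ε/10` from the roll-outs and `7ε/10` from
  -- planning, with `Hρ ≤ ε / 10000`.
  linarith
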